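/- Let $\mathcal I$ be a nonempty totally ordered set with a fixed effective coding of its elements (for example $\mathbb Z$ or $\mathbb Q$), let $k\ge 0$, and let $\alpha$ be a $k$-ary aggregation function over $\mathcal I$, that is, a function from the finite bags (multisets) of elements of $\mathcal I^k$ to some set of values. *Queries.* A term is a variable or a constant from $\mathcal I$. A condition is a finite conjunction of literals, where a literal is a relational atom $p(t_1,\dots,t_n)$, a negated relational atom $\neg p(t_1,\dots,t_n)$, or a comparison $s\mathrel\rho t$ with $\rho\in\{<,\le,>,\ge,=,\ne\}$. A condition is safe if each of its variables is limited, where a variable is limited if it occurs in a non-negated relational atom of the condition or is equated by the condition with a constant or with a limited variable. A disjunctive $\alpha$-query (with negation allowed, and comparisons ranging over $\mathcal I$) is an expression $q(\bar x,\alpha(\bar y))\leftarrow A_1\vee\dots\vee A_n$, where $\bar x$ is a tuple of variables, $\bar y$ is a $k$-tuple of variables, and the $A_i$ are safe conditions each containing all variables of $\bar x$ and $\bar y$. It is positive if no negated relational atom occurs in it. A database $\mathcal D$ is a finite set of ground relational atoms with constants from $\mathcal I$; its carrier is the set of constants occurring in it. For a tuple $\bar d$ of constants, let $B_{\bar d}(q,\mathcal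 D)$ be the bag that contains, for each $i$ and each assignment $\gamma$ of the variables of $A_i$ that satisfies $A_i$ over $\mathcal D$ and has $\gamma(\bar x)=\bar d$, one copy of $\gamma(\bar y)$ (so an assignment counts once for each disjunct that it satisfies). The result of $q$ over $\mathcal D$ is $\{(\bar d,\alpha(B_{\bar d}(q,\mathcal D))) : B_{\bar d}(q,\mathcal D)\neq\emptyset\}$. Two queries are $N$-equivalent if they have the same result over every database whose carrier has at most $N$ elements. The bounded equivalence problem for a class of queries is to decide, given $N>0$ and $q,q'$ from the class, whether $q$ and $q'$ are $N$-equivalent. *Order-decidability.* Let $L$ be a conjunction of comparisons between terms of a finite set $T$ of terms. $L$ entails a comparison if every assignment of elements of $\mathcal I$ to the variables that satisfies $L$ satisfies the comparison. $L$ is a complete ordering of $T$ if for all $t,t'\in T$ exactly one of $t<t'$, $t>t'$, $t=t'$ is entailed by $L$. An ordered identity for $\alpha$ is a formula $L\to\alpha(B)=\alpha(B')$ where $L$ is a complete ordering of a finite set $T$ of terms and $B,B'$ are finite bags of $k$-tuples of terms from $T$. It is valid if $\alpha(\delta(B))=\alpha(\delta(B'))$ for every assignment $\delta$ satisfying $L$.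 The function $\alpha$ is order-decidable over $\mathcal I$ if the set of valid ordered identities for $\alpha$ (each given by $T,L,B,B'$) is decidable. **Corollary (Bounded Equivalence of Queries Without Negation).** The following are equivalent: 1. the bounded equivalence problem is decidable for positive disjunctive $\alpha$-queries with comparisons ranging over $\mathcal I$; 2. the bounded equivalence problem is decidable for disjunctive $\alpha$-queries with negation and comparisons ranging over $\mathcal I$; 3. $\alpha$ is order-decidable over $\mathcal I$. -/

import Mathlib

namespace AggregateQuery

universe u v

/-! ### Syntax -/

/-- A term is a variable (numbered by a natural number) or a constant of the domain `I`. -/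
inductive Term (I : Type u) : Type u
  | var (x : ℕ) : Term I
  | const (c : I) : Term I

/-- The six ordering predicates. -/
inductive OrdRel : Type
  | lt | le | gt | ge | eq | ne

/-- An ordering atom (comparison) `lhs rel rhs`. -/
structure OrdAtom (I : Type u) : Type u where
  lhs : Term I
  rel : OrdRel
  rhs : Term I

/-- A relational atom `p(t₁, …, tₙ)`. A predicate symbol is a name together with an arity, so there
are infinitely many predicate symbols of each arity. -/
structure Atom (I : Type u) : Type u where
  pred : ℕ
  args : List (Term I)

/-- A literal: a positive relational atom, a negated relational atom, or a comparison. -/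
inductive Literal (I : Type u) : Type u
  | pos (a : Atom I) : Literal I
  | neg (a : Atom I) : Literal I
  | cmp (o : OrdAtom I) : Literal I

/-- A condition is a finite conjunction of literals. -/
abbrev Condition (I : Type u) : Type u := List (Literal I)

/-- The syntax of an aggregate query `q(x̄, α(ȳ)) ← A₁ ∨ … ∨ Aₙ` for a `k`-ary aggregation
function: the grouping variables `x̄`, the aggregation variables `ȳ`, and the disjuncts. -/
structure Query (I : Type u) (k : ℕ) : Type u where
  group : List ℕ
  agg : Fin k → ℕ
  body : List (Condition I)

/-! ### Effective codings of the syntax -/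

def Term.equiv (I : Type u) : Term I ≃ ℕ ⊕ I where
  toFun
    | .var x => .inl x
    | .const c => .inr c
  invFun
    | .inl x => .var x
    | .inr c => .const c
  left_inv := by rintro (_ | _) <;> rfl
  right_inv := by rintro (_ | _) <;> rfl

def OrdRel.equiv : OrdRel ≃ Fin 6 where
  toFun
    | .lt => 0
    | .le => 1
    | .gt => 2
    | .ge => 3
    | .eq => 4
    | .ne => 5
  invFun
    | 0 => .lt
    | 1 => .le
    | 2 => .gt
    | 3 => .ge
    | 4 => .eq
    | 5 => .ne
  left_inv := by rintro (_ | _) <;> rfl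
  right_inv := by decide

def OrdAtom.equiv (I : Type u) : OrdAtom I ≃ Term I × OrdRel × Term I where
  toFun o := (o.lhs, o.rel, o.rhs)
  invFun o := ⟨o.1, o.2.1, o.2.2⟩
  left_inv _ := rfl
  right_inv _ := rfl

def Atom.equiv (I : Type u) : Atom I ≃ ℕ × List (Term I) where
  toFun a := (a.pred, a.args)
  invFun a := ⟨a.1, a.2⟩
  left_inv _ := rfl
  right_inv _ := rfl

def Literal.equiv (I : Type u) : Literal I ≃ Atom I ⊕ Atom I ⊕ OrdAtom I where
  toFun
    | .pos a => .inl a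
    | .neg a => .inr (.inl a)
    | .cmp o => .inr (.inr o)
  invFun
    | .inl a => .pos a
    | .inr (.inl a) => .neg a
    | .inr (.inr o) => .cmp o
  left_inv := by rintro (_ | _ | _) <;> rfl
  right_inv := by rintro (_ | _ | _) <;> rfl

def Query.equiv (I : Type u) (k : ℕ) :
    Query I k ≃ List ℕ × (Fin k → ℕ) × List (Condition I) where
  toFun q := (q.group, q.agg, q.body)
  invFun q := ⟨q.1, q.2.1, q.2.2⟩
  left_inv _ := rfl
  right_inv _ := rfl

instance {I : Type u} [Primcodable I] : Primcodable (Term I) :=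
  Primcodable.ofEquiv _ (Term.equiv I)

instance : Primcodable OrdRel :=
  Primcodable.ofEquiv _ OrdRel.equiv

instance {I : Type u} [Primcodable I] : Primcodable (OrdAtom I) :=
  Primcodable.ofEquiv _ (OrdAtom.equiv I)

instance {I : Type u} [Primcodable I] : Primcodable (Atom I) :=
  Primcodable.ofEquiv _ (Atom.equiv I)

instance {I : Type u} [Primcodable I] : Primcodable (Literal I) :=
  Primcodable.ofEquiv _ (Literal.equiv I)

instance {I : Type u} [Primcodable I] {k : ℕ} : Primcodable (Query I k) :=
  Primcodable.ofEquiv _ (Query.equiv I k)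

/-! ### Well-formed (safe) and positive queries -/

/-- The terms occurring in a literal. -/
def Literal.terms {I : Type u} : Literal I → List (Term I)
  | .pos a => a.args
  | .neg a => a.args
  | .cmp o => [o.lhs, o.rhs]

/-- The variable `x` occurs in the condition `A`. -/
def Occurs {I : Type u} (A : Condition I) (x : ℕ) : Prop :=
  ∃ l ∈ A, Term.var x ∈ l.terms

/-- The condition `A` contains the equality `s = t` or `t = s`. -/
def Equates {I : Type u} (A : Condition I) (s t : Term I) : Prop :=
  Literal.cmp ⟨s, .eq, t⟩ ∈ A ∨ Literal.cmp ⟨t, .eq, s⟩ ∈ A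

/-- The limited variables of a condition: those that occur in a positive relational atom or are
equated with a constant or with a limited variable. -/
inductive Limited {I : Type u} (A : Condition I) : ℕ → Prop
  | atom {a : Atom I} {x : ℕ} : Literal.pos a ∈ A → Term.var x ∈ a.args → Limited A x
  | eqConst {x : ℕ} {c : I} : Equates A (.var x) (.const c) → Limited A x
  | eqVar {x y : ℕ} : Limited A y → Equates A (.var x) (.var y) → Limited A x

/-- A condition is safe if all its variables are limited. -/
def Safe {I : Type u} (A : Condition I) : Prop := ∀ x, Occurs A x → Limited A x

/-- Disjunctive aggregate queries, with negation allowed: every disjunct is safe and contains all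
the variables of the head. -/
def Query.IsDisjunctive {I : Type u} {k : ℕ} (q : Query I k) : Prop :=
  ∀ A ∈ q.body, Safe A ∧ (∀ x ∈ q.group, Occurs A x) ∧ ∀ j, Occurs A (q.agg j)

/-- Positive disjunctive aggregate queries: no negated relational atom occurs in the body. -/
def Query.IsPositiveDisjunctive {I : Type u} {k : ℕ} (q : Query I k) : Prop :=
  q.IsDisjunctive ∧ ∀ A ∈ q.body, ∀ a : Atom I, Literal.neg a ∉ A

/-! ### Semantics -/

/-- The value of a term under an assignment; constants are mapped to themselves. -/
def Term.eval {I : Type u} (γ : ℕ → I) : Term I → I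
  | .var x => γ x
  | .const c => c

/-- The meaning of the ordering predicates. -/
def OrdRel.Holds {I : Type u} [LinearOrder I] : OrdRel → I → I → Prop
  | .lt, a, b => a < b
  | .le, a, b => a ≤ b
  | .gt, a, b => a > b
  | .ge, a, b => a ≥ b
  | .eq, a, b => a = b
  | .ne, a, b => a ≠ b

/-- The assignment `γ` satisfies an ordering atom. -/
def OrdAtom.Sat {I : Type u} [LinearOrder I] (γ : ℕ → I) (o : OrdAtom I) : Prop :=
  o.rel.Holds (o.lhs.eval γ) (o.rhs.eval γ)

/-- A database is a finite set of ground relational atoms `p(c₁, …, cₙ)`. -/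
abbrev Database (I : Type u) : Type u := Finset (ℕ × List I)

/-- The carrier of a database: the set of the constants occurring in it. -/
def carrier {I : Type u} [LinearOrder I] (D : Database I) : Finset I :=
  D.biUnion fun a => a.2.toFinset

/-- The assignment `γ` satisfies a literal over the database `D`. -/
def Literal.Sat {I : Type u} [LinearOrder I] (D : Database I) (γ : ℕ → I) : Literal I → Prop
  | .pos a => (a.pred, a.args.map (Term.eval γ)) ∈ D
  | .neg a => (a.pred, a.args.map (Term.eval γ)) ∉ D
  | .cmp o => o.Sat γ

/-- The satisfying assignments of the condition `A` over `D`. An assignment is defined on the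
variables of `A` only; it is represented by its extension that has a fixed value on all other
variables, so that each assignment is counted once. -/
def satAssignments {I : Type u} [LinearOrder I] [Nonempty I] (A : Condition I) (D : Database I) :
    Set (ℕ → I) :=
  {γ | (∀ x, ¬ Occurs A x → γ x = Classical.arbitrary I) ∧ ∀ l ∈ A, l.Sat D γ}

theorem satAssignments_finite {I : Type u} [LinearOrder I] [Nonempty I] {A : Condition I}
    (hA : Safe A) (D : Database I) : (satAssignments A D).Finite := by
  classical
  have hterms : {t : Term I | ∃ l ∈ A, t ∈ l.terms}.Finite := by
    refine (List.finite_toSet (A.flatMap Literal.terms)).subset ?_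
    rintro t ⟨l, hl, ht⟩
    exact List.mem_flatMap.2 ⟨l, hl, ht⟩
  have hC : {c : I | ∃ l ∈ A, Term.const c ∈ l.terms}.Finite :=
    hterms.preimage (f := Term.const) fun a _ b _ h => by simpa using h
  have hV : {x : ℕ | Occurs A x}.Finite :=
    hterms.preimage (f := Term.var) fun a _ b _ h => by simpa using h
  have hF := (carrier D).finite_toSet.union hC
  have key : ∀ γ ∈ satAssignments A D, ∀ x, Limited A x →
      γ x ∈ (carrier D : Set I) ∪ {c : I | ∃ l ∈ A, Term.const c ∈ l.terms} := by
    rintro γ ⟨-, hγ⟩ x hx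
    induction hx with
    | @atom a x ha hx =>
      left
      have := hγ _ ha
      simp only [carrier, Finset.coe_biUnion, Set.mem_iUnion]
      refine ⟨_, this, ?_⟩
      simp only [List.coe_toFinset, Set.mem_ofPred_eq, List.mem_map]
      exact ⟨_, hx, rfl⟩
    | @eqConst x c h =>
      right
      rcases h with h | h
      · have e : γ x = c := hγ _ h
        exact ⟨_, h, by simp [Literal.terms, e]⟩
      · have e : c = γ x := hγ _ h
        exact ⟨_, h, by simp [Literal.terms, e]⟩
    | @eqVar x y _ h ih =>
      rcases h with h | h
      · have e : γ x = γ y := hγ _ h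
        rwa [e]
      · have e : γ y = γ x := hγ _ h
        rwa [← e]
  have := hV.to_subtype
  have hpi := Set.Finite.pi' (ι := {x : ℕ | Occurs A x}) fun _ => hF
  refine Set.Finite.of_finite_image (f := fun γ (x : {x : ℕ | Occurs A x}) => γ x)
    (hpi.subset ?_) ?_
  · rintro _ ⟨γ, hγ, rfl⟩ x
    exact key γ hγ x (hA x x.2)
  · intro γ hγ γ' hγ' h
    funext x
    by_cases hx : Occurs A x
    · exact congrFun h ⟨x, hx⟩
    · rw [hγ.1 x hx, hγ'.1 x hx]

/-- The bag of the tuples `γ(ȳ)`, where `γ` ranges over the satisfying assignments of `A` over `D`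
with `γ(x̄) = d`. Safe conditions have finitely many satisfying assignments
(`satAssignments_finite`), so the second branch is never taken for queries in the classes above. -/
noncomputable def conditionBag {I : Type u} [LinearOrder I] [Nonempty I] {k : ℕ}
    (A : Condition I) (D : Database I) (xs : List ℕ) (ys : Fin k → ℕ) (d : List I) :
    Multiset (Fin k → I) :=
  open Classical in
  if h : {γ ∈ satAssignments A D | xs.map γ = d}.Finite then
    h.toFinset.val.map fun γ j => γ (ys j)
  else 0

/-- The bag that the query `q` collects over `D` for the group `d`: the bags of the disjuncts are
added up, so an assignment is counted once for each disjunct that it satisfies. -/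
noncomputable def Query.bag {I : Type u} [LinearOrder I] [Nonempty I] {k : ℕ}
    (q : Query I k) (D : Database I) (d : List I) : Multiset (Fin k → I) :=
  (q.body.map fun A => conditionBag A D q.group q.agg d).sum

/-- The result of the `α`-query `q` over `D`: one tuple `(d, α(B))` for each group `d` whose bag
`B` is nonempty. -/
def Query.result {I : Type u} [LinearOrder I] [Nonempty I] {β : Type v} {k : ℕ}
    (α : Multiset (Fin k → I) → β) (q : Query I k) (D : Database I) : Set (List I × β) :=
  {r | q.bag D r.1 ≠ 0 ∧ r.2 = α (q.bag D r.1)}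

/-- `N`-equivalence: equal results over all databases whose carrier has at most `N` elements. -/
def NEquivalent {I : Type u} [LinearOrder I] [Nonempty I] {β : Type v} {k : ℕ}
    (α : Multiset (Fin k → I) → β) (N : ℕ) (q q' : Query I k) : Prop :=
  ∀ D : Database I, (carrier D).card ≤ N → q.result α D = q'.result α D

/-- The bounded equivalence problem for the `α`-queries of the class `C` is decidable: given
`N > 0` and `q`, `q'` in `C`, it is decidable whether `q` and `q'` are `N`-equivalent. -/
def BoundedEquivalenceDecidable {I : Type u} [LinearOrder I] [Nonempty I] [Primcodable I]
    {β : Type v} {k : ℕ} (α : Multiset (Fin k → I) → β) (C : Query I k → Prop) : Prop :=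
  ComputablePred fun i : ℕ × Query I k × Query I k =>
    0 < i.1 ∧ C i.2.1 ∧ C i.2.2 ∧ NEquivalent α i.1 i.2.1 i.2.2

/-! ### Ordered identities -/

/-- The conjunction `L` of ordering atoms entails the atom `s ρ t` with respect to `I`. -/
def Entails {I : Type u} [LinearOrder I] (L : List (OrdAtom I)) (s : Term I) (ρ : OrdRel)
    (t : Term I) : Prop :=
  ∀ δ : ℕ → I, (∀ o ∈ L, o.Sat δ) → ρ.Holds (s.eval δ) (t.eval δ)

/-- `L` is a complete ordering of the set of terms `T` with respect to `I`: a conjunction of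
ordering atoms over `T` such that, for all `s`, `t` in `T`, exactly one of `s < t`, `s > t`,
`s = t` is entailed. -/
def IsCompleteOrdering {I : Type u} [LinearOrder I] (L : List (OrdAtom I)) (T : List (Term I)) :
    Prop :=
  (∀ o ∈ L, o.lhs ∈ T ∧ o.rhs ∈ T) ∧
  ∀ s ∈ T, ∀ t ∈ T,
    (Entails L s .lt t ∧ ¬ Entails L s .gt t ∧ ¬ Entails L s .eq t) ∨
    (¬ Entails L s .lt t ∧ Entails L s .gt t ∧ ¬ Entails L s .eq t) ∨
    (¬ Entails L s .lt t ∧ ¬ Entails L s .gt t ∧ Entails L s .eq t)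

/-- The instantiation `δ(B)` of a bag `B` of `k`-tuples of terms (given as a list). -/
def instBag {I : Type u} {k : ℕ} (δ : ℕ → I) (B : List (Fin k → Term I)) :
    Multiset (Fin k → I) :=
  ((B.map fun s j => (s j).eval δ : List (Fin k → I)) : Multiset (Fin k → I))

/-- The data `(T, L, B, B')` of a formula `L → α(B) = α(B')`. -/
abbrev IdentityData (I : Type u) (k : ℕ) : Type u :=
  List (Term I) × List (OrdAtom I) × List (Fin k → Term I) × List (Fin k → Term I)

/-- The data `(T, L, B, B')` forms an ordered identity: `L` is a complete ordering of `T` and `B`,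
`B'` are bags of `k`-tuples of terms from `T`. -/
def IsOrderedIdentity {I : Type u} [LinearOrder I] {k : ℕ} : IdentityData I k → Prop
  | (T, L, B, B') =>
    IsCompleteOrdering L T ∧ (∀ s ∈ B, ∀ j, s j ∈ T) ∧ (∀ s ∈ B', ∀ j, s j ∈ T)

/-- The formula `L → α(B) = α(B')` is valid over `I`. -/
def IdentityValid {I : Type u} [LinearOrder I] {β : Type v} {k : ℕ}
    (α : Multiset (Fin k → I) → β) : IdentityData I k → Prop
  | (_, L, B, B') => ∀ δ : ℕ → I, (∀ o ∈ L, o.Sat δ) → α (instBag δ B) = α (instBag δ B')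

/-- `α` is order-decidable over `I`: the set of the valid ordered identities for `α` is
decidable. -/
def OrderDecidable {I : Type u} [LinearOrder I] [Primcodable I] {β : Type v} {k : ℕ}
    (α : Multiset (Fin k → I) → β) : Prop :=
  ComputablePred fun i : IdentityData I k => IsOrderedIdentity i ∧ IdentityValid α i

end AggregateQuery

/-! ### Closure properties of primitive recursive and computable predicates -/

section Computability

variable {α β σ : Type*} [Primcodable α] [Primcodable β] [Primcodable σ]

/-! The implications proved are 1 → 3 → 2 → 1. For 2 → 1, positivity is a decidable syntactic
property, so it can be tested separately.

3 → 2. Safety confines satisfying assignments to the carrier and the constants of the queries. A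
database with at most `N` carrier elements therefore has a symbolic description: the list `T` of the
constants of both queries and of `m ≤ N` variables naming the other carrier elements, a full order
diagram `L` of `T`, and a list `E` of facts over at most `N` terms of `T`. Whether an assignment of
terms satisfies a condition depends on `L` and `E` alone. So for each group a query collects a
computable symbolic bag `B`, and `δ(B)` is the real bag for every model `δ` of `L`
(`Query.bag_eq_instBag`). Hence `N`-equivalence amounts to finitely many checks that two symbolic
bags are both empty, or both nonempty with `L → α(B) = α(B')` valid (`NEquivalent.symEquivalent`,
`SymEquivalent.nEquivalent`). The enumeration around these checks is primitive recursive.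

1 → 3. A bag `B` over `T` becomes a positive query with one disjunct per element of `B`: the
disjunct reads the tuple `T` from a single relation, requires `L`, and equates the aggregation
variables with that element; the query groups by all variables of `T`. For the group given by a
model `δ` it collects exactly `δ(B)` (`bag_tupleQuery`), so equivalence of two such queries
expresses the identity, except that an empty bag yields no result instead of `α(∅)`. An empty bag is
therefore replaced by a fixed nonempty bag of constants with the same value; if there is none, the
value `α(∅)` singles out the empty bag just as the missing result does (`identityValid_iff`).
Completeness of `L` is decided through entailment: `L` entails a comparison iff the query requiring
`L` and the negated comparison never returns anything (`entails_iff`). -/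

theorem PrimrecPred.ball {f : α → List β} {p : α → β → Prop} (hf : Primrec f)
    (hp : PrimrecRel p) : PrimrecPred fun a => ∀ b ∈ f a, p a b :=
  (PrimrecRel.forall_mem_list (R := fun b a => p a b) hp.swap).comp hf Primrec.id

theorem PrimrecPred.bex {f : α → List β} {p : α → β → Prop} (hf : Primrec f)
    (hp : PrimrecRel p) : PrimrecPred fun a => ∃ b ∈ f a, p a b :=
  (PrimrecRel.exists_mem_list (R := fun b a => p a b) hp.swap).comp hf Primrec.id

theorem PrimrecPred.imp {p q : α → Prop} (hp : PrimrecPred p) (hq : PrimrecPred q) :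
    PrimrecPred fun a => p a → q a :=
  (hp.not.or hq).of_eq fun a => by tauto

theorem PrimrecPred.list_mem {f : α → β} {g : α → List β} (hf : Primrec f) (hg : Primrec g) :
    PrimrecPred fun a => f a ∈ g a :=
  (PrimrecPred.bex hg (p := fun a b => b = f a)
    (Primrec.eq.comp Primrec.snd (hf.comp Primrec.fst))).of_eq fun a => by simp

theorem Primrec.list_filter {f : α → List β} {p : α → β → Prop} [∀ a, DecidablePred (p a)]
    (hf : Primrec f) (hp : PrimrecRel p) : Primrec fun a => (f a).filter fun b => p a b := by
  have h : Primrec fun a => (f a).flatMap fun b => if p a b then [b] else [] :=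
    Primrec.list_flatMap hf <| Primrec.ite (c := fun x : α × β => p x.1 x.2) hp
      (Primrec.list_cons.comp Primrec.snd (Primrec.const [])) (Primrec.const [])
  refine h.of_eq fun a => ?_
  induction f a with
  | nil => rfl
  | cons b l ih =>
    rw [List.flatMap_cons, ih, List.filter_cons]
    by_cases hb : p a b <;> simp [hb]

theorem Primrec.list_dedup [DecidableEq α] : Primrec (List.dedup : List α → List α) := by
  have h : Primrec fun l : List α =>
      l.foldr (fun a acc => if a ∈ acc then acc else a :: acc) [] :=
    Primrec.list_foldr (h := fun _ x => if x.1 ∈ x.2 then x.2 else x.1 :: x.2) Primrec.id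
      (Primrec.const []) <|
      Primrec.ite (c := fun x : List α × α × List α => x.2.1 ∈ x.2.2)
        (PrimrecPred.list_mem (Primrec.fst.comp Primrec.snd) (Primrec.snd.comp Primrec.snd))
        (Primrec.snd.comp Primrec.snd)
        (Primrec.list_cons.comp (Primrec.fst.comp Primrec.snd) (Primrec.snd.comp Primrec.snd))
  refine h.of_eq fun l => ?_
  induction l with
  | nil => rfl
  | cons a l ih =>
    rw [List.foldr_cons, ih]
    by_cases ha : a ∈ l
    · simp [ha]
    · simp [ha]

theorem Primrec.list_sublists' : Primrec (List.sublists' : List α → List (List α)) := by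
  have h : Primrec fun l : List α =>
      l.foldr (fun a acc => acc ++ acc.map (a :: ·)) [[]] :=
    Primrec.list_foldr (h := fun _ x => x.2 ++ x.2.map (x.1 :: ·)) Primrec.id
      (Primrec.const [[]]) <|
      Primrec.list_append.comp (Primrec.snd.comp Primrec.snd) <|
        Primrec.list_map (g := fun x b => x.2.1 :: b) (Primrec.snd.comp Primrec.snd) <|
          Primrec.list_cons.comp (Primrec.fst.comp (Primrec.snd.comp Primrec.fst)) Primrec.snd
  refine h.of_eq fun l => ?_
  induction l with
  | nil => rfl
  | cons a l ih => rw [List.foldr_cons, ih, List.sublists'_cons]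

/-- All lists of length `n` with entries from `T`. -/
def listsOf {α : Type*} (T : List α) : ℕ → List (List α)
  | 0 => [[]]
  | n + 1 => T.flatMap fun t => (listsOf T n).map (t :: ·)

theorem mem_listsOf {α : Type*} {T : List α} {n : ℕ} {l : List α} :
    l ∈ listsOf T n ↔ l.length = n ∧ ∀ t ∈ l, t ∈ T := by
  induction n generalizing l with
  | zero => cases l <;> simp [listsOf]
  | succ n ih =>
    cases l with
    | nil => simp [listsOf]
    | cons a l =>
      simp [listsOf, ih]
      tauto

theorem nodup_listsOf {α : Type*} {T : List α} (hT : T.Nodup) (n : ℕ) : (listsOf T n).Nodup := by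
  induction n with
  | zero => simp [listsOf]
  | succ n ih =>
    refine List.nodup_flatMap.2 ⟨fun t _ => ih.map fun _ _ h => by simpa using h, ?_⟩
    refine hT.imp fun {a b} hab => ?_
    simp only [Function.onFun, List.disjoint_left, List.mem_map, not_exists, not_and]
    rintro _ ⟨l, -, rfl⟩ l' - h
    exact hab (List.cons.inj h).1.symm

theorem Primrec.listsOf {f : α → List β} {g : α → ℕ} (hf : Primrec f) (hg : Primrec g) :
    Primrec fun a => listsOf (f a) (g a) := by
  have h := Primrec.nat_rec' (h := fun a (x : ℕ × List (List β)) =>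
    (f a).flatMap fun t => x.2.map (t :: ·)) hg (Primrec.const [[]])
    (Primrec.list_flatMap (hf.comp Primrec.fst) <|
      Primrec.list_map (Primrec.snd.comp (Primrec.snd.comp Primrec.fst)) <|
        Primrec.list_cons.comp (Primrec.snd.comp Primrec.fst) Primrec.snd)
  refine h.of_eq fun a => ?_
  induction g a with
  | zero => rfl
  | succ n ih =>
    show (f a).flatMap _ = _
    rw [_root_.listsOf]
    simp only [ih]

theorem ComputablePred.comp {p : β → Prop} {f : α → β} (hp : ComputablePred p)
    (hf : Computable f) : ComputablePred fun a => p (f a) := by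
  obtain ⟨_, hp⟩ := hp
  exact ⟨inferInstance, hp.comp hf⟩

theorem ComputablePred.and {p q : α → Prop} (hp : ComputablePred p) (hq : ComputablePred q) :
    ComputablePred fun a => p a ∧ q a := by
  obtain ⟨_, hp⟩ := hp
  obtain ⟨_, hq⟩ := hq
  exact ⟨inferInstance, (Primrec.and.to_comp.comp hp hq).of_eq fun a => by simp⟩

theorem ComputablePred.or {p q : α → Prop} (hp : ComputablePred p) (hq : ComputablePred q) :
    ComputablePred fun a => p a ∨ q a :=
  (hp.not.and hq.not).not.of_eq fun a => by tauto

theorem ComputablePred.imp {p q : α → Prop} (hp : ComputablePred p) (hq : ComputablePred q) :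
    ComputablePred fun a => p a → q a :=
  (hp.not.or hq).of_eq fun a => by tauto

/-- The bounded quantifier is needed for predicates that are merely computable, since they will call
a decision procedure for identities or queries. The list is scanned by recursion on an index. -/
theorem ComputablePred.ball {f : α → List β} {p : α × β → Prop} (hf : Computable f)
    (hp : ComputablePred p) : ComputablePred fun a => ∀ b ∈ f a, p (a, b) := by
  classical
  have hp := hp.decide
  -- The default `true` makes a missing entry vacuous; indices stay below the length, so it never
  -- affects the result.
  have h : Computable fun a => Nat.rec (motive := fun _ => Bool) true
      (fun n acc => acc && ((f a)[n]?.elim true fun b => decide (p (a, b)))) (f a).length := by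
    refine Computable.nat_rec (h := fun a (x : ℕ × Bool) =>
      x.2 && ((f a)[x.1]?.elim true fun b => decide (p (a, b))))
      (Computable.list_length.comp hf) (Computable.const true) ?_
    refine Primrec.and.to_comp.comp (Computable.snd.comp Computable.snd) ?_
    refine (Computable.option_casesOn (o := fun x : α × ℕ × Bool => (f x.1)[x.2.1]?)
      (f := fun _ => true) (g := fun x b => decide (p (x.1, b)))
      (Computable.list_getElem?.comp (hf.comp Computable.fst)
        (Computable.fst.comp Computable.snd)) (Computable.const true)
      (hp.comp (Computable.pair (Computable.fst.comp Computable.fst) Computable.snd))).of_eq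
      fun x => ?_
    cases (f x.1)[x.2.1]? <;> rfl
  refine ComputablePred.computable_iff.2 ⟨_, h, funext fun a => propext ?_⟩
  have key : ∀ n, (Nat.rec (motive := fun _ => Bool) true
      (fun n acc => acc && ((f a)[n]?.elim true fun b => decide (p (a, b)))) n = true) ↔
      ∀ i < n, ∀ b, (f a)[i]? = some b → p (a, b) := by
    intro n
    induction n with
    | zero => simp
    | succ n ih =>
      rw [Bool.and_eq_true, ih, Nat.forall_lt_succ_right]
      refine and_congr_right fun _ => ?_
      cases (f a)[n]? <;> simp
  rw [key]
  constructor
  · intro h i _ b hb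
    exact h b (List.mem_of_getElem? hb)
  · intro h b hb
    obtain ⟨i, hi, rfl⟩ := List.getElem_of_mem hb
    exact h i hi _ (List.getElem?_eq_getElem hi)

end Computability

namespace AggregateQuery

universe u v

/-! ### The syntax is primitive recursive -/

section Coding

variable {I : Type u} [Primcodable I] {k : ℕ} {α σ : Type*} [Primcodable α] [Primcodable σ]

theorem Term.primrec_var : Primrec (Term.var : ℕ → Term I) :=
  (Primrec.of_equiv_symm (e := Term.equiv I)).comp Primrec.sumInl

theorem Term.primrec_const : Primrec (Term.const : I → Term I) :=
  (Primrec.of_equiv_symm (e := Term.equiv I)).comp Primrec.sumInr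

theorem Term.primrec_casesOn {f : α → Term I} {g : α → ℕ → σ} {h : α → I → σ} (hf : Primrec f)
    (hg : Primrec₂ g) (hh : Primrec₂ h) :
    Primrec fun a => Term.casesOn (motive := fun _ => σ) (f a) (g a) (h a) :=
  (Primrec.sumCasesOn ((Primrec.of_equiv (e := Term.equiv I)).comp hf) hg hh).of_eq fun a => by
    cases f a <;> rfl

/-- Finiteness makes every function on `OrdRel`, in particular negation, primitive recursive. -/
instance : Finite OrdRel := Finite.of_equiv _ OrdRel.equiv.symm

theorem OrdAtom.primrec_equiv : Primrec (OrdAtom.equiv I) := Primrec.of_equiv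

theorem OrdAtom.primrec_lhs : Primrec (OrdAtom.lhs : OrdAtom I → Term I) :=
  Primrec.fst.comp OrdAtom.primrec_equiv

theorem OrdAtom.primrec_rel : Primrec (OrdAtom.rel : OrdAtom I → OrdRel) :=
  (Primrec.fst.comp Primrec.snd).comp OrdAtom.primrec_equiv

theorem OrdAtom.primrec_rhs : Primrec (OrdAtom.rhs : OrdAtom I → Term I) :=
  (Primrec.snd.comp Primrec.snd).comp OrdAtom.primrec_equiv

theorem OrdAtom.primrec_mk {f : α → Term I} {r : α → OrdRel} {g : α → Term I} (hf : Primrec f)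
    (hr : Primrec r) (hg : Primrec g) : Primrec fun a => (⟨f a, r a, g a⟩ : OrdAtom I) :=
  (Primrec.of_equiv_symm (e := OrdAtom.equiv I)).comp (hf.pair (hr.pair hg))

theorem Atom.primrec_pred : Primrec (Atom.pred : Atom I → ℕ) :=
  Primrec.fst.comp (Primrec.of_equiv (e := Atom.equiv I))

theorem Atom.primrec_args : Primrec (Atom.args : Atom I → List (Term I)) :=
  Primrec.snd.comp (Primrec.of_equiv (e := Atom.equiv I))

theorem Atom.primrec_mk {f : α → ℕ} {g : α → List (Term I)} (hf : Primrec f) (hg : Primrec g) :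
    Primrec fun a => (⟨f a, g a⟩ : Atom I) :=
  (Primrec.of_equiv_symm (e := Atom.equiv I)).comp (hf.pair hg)

theorem Literal.primrec_pos : Primrec (Literal.pos : Atom I → Literal I) :=
  (Primrec.of_equiv_symm (e := Literal.equiv I)).comp Primrec.sumInl

theorem Literal.primrec_cmp : Primrec (Literal.cmp : OrdAtom I → Literal I) :=
  (Primrec.of_equiv_symm (e := Literal.equiv I)).comp (Primrec.sumInr.comp Primrec.sumInr)

theorem Literal.primrec_casesOn {f : α → Literal I} {g : α → Atom I → σ} {h : α → Atom I → σ}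
    {c : α → OrdAtom I → σ} (hf : Primrec f) (hg : Primrec₂ g) (hh : Primrec₂ h)
    (hc : Primrec₂ c) :
    Primrec fun a => Literal.casesOn (motive := fun _ => σ) (f a) (g a) (h a) (c a) := by
  refine (Primrec.sumCasesOn ((Primrec.of_equiv (e := Literal.equiv I)).comp hf) hg
    (h := fun a y => Sum.casesOn (motive := fun _ => σ) y (h a) (c a))
    (Primrec.sumCasesOn (f := fun x : α × (Atom I ⊕ OrdAtom I) => x.2)
      (g := fun x => h x.1) (h := fun x => c x.1) Primrec.snd ?_ ?_)).of_eq fun a => ?_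
  · exact hh.comp (Primrec.fst.comp Primrec.fst) Primrec.snd
  · exact hc.comp (Primrec.fst.comp Primrec.fst) Primrec.snd
  · cases f a <;> rfl

theorem Literal.primrecPred_casesOn {f : α → Literal I} {g : α → Atom I → Prop}
    {h : α → Atom I → Prop} {c : α → OrdAtom I → Prop} (hf : Primrec f) (hg : PrimrecRel g)
    (hh : PrimrecRel h) (hc : PrimrecRel c) :
    PrimrecPred fun a =>
      Literal.casesOn (motive := fun _ => Prop) (f a) (g a) (h a) (c a) := by
  classical
  refine primrecPred_iff_primrec_decide.2
    ((Literal.primrec_casesOn hf hg.decide hh.decide hc.decide).of_eq fun a => ?_)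
  cases f a <;> simp

theorem Query.primrec_group : Primrec (Query.group : Query I k → List ℕ) :=
  Primrec.fst.comp (Primrec.of_equiv (e := Query.equiv I k))

theorem Query.primrec_agg : Primrec (Query.agg : Query I k → Fin k → ℕ) :=
  (Primrec.fst.comp Primrec.snd).comp (Primrec.of_equiv (e := Query.equiv I k))

theorem Query.primrec_body : Primrec (Query.body : Query I k → List (Condition I)) :=
  (Primrec.snd.comp Primrec.snd).comp (Primrec.of_equiv (e := Query.equiv I k))

theorem Query.primrec_mk {f : α → List ℕ} {g : α → Fin k → ℕ} {h : α → List (Condition I)}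
    (hf : Primrec f) (hg : Primrec g) (hh : Primrec h) :
    Primrec fun a => (⟨f a, g a, h a⟩ : Query I k) :=
  (Primrec.of_equiv_symm (e := Query.equiv I k)).comp (hf.pair (hg.pair hh))

end Coding

/-! ### Variables and constants -/

/-- The list of the variables of a term. -/
def Term.vars {I : Type u} : Term I → List ℕ
  | .var x => [x]
  | .const _ => []

/-- The list of the constants of a term, as terms. -/
def Term.consts {I : Type u} : Term I → List (Term I)
  | .var _ => []
  | .const c => [.const c]

/-- The list of the terms of a condition. -/
def condTerms {I : Type u} (A : Condition I) : List (Term I) := A.flatMap Literal.terms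

/-- The list of the variables of a condition. -/
def condVars {I : Type u} (A : Condition I) : List ℕ := (condTerms A).flatMap Term.vars

theorem Term.mem_vars {I : Type u} {t : Term I} {x : ℕ} : x ∈ t.vars ↔ t = .var x := by
  cases t <;> simp [Term.vars, eq_comm]

theorem Term.mem_consts {I : Type u} {t s : Term I} : s ∈ t.consts ↔ t = s ∧ ∃ c, s = .const c := by
  cases t <;> simp [Term.consts]
  · rintro rfl; simp
  · exact ⟨fun h => ⟨h.symm, _, h⟩, fun h => h.1.symm⟩

theorem mem_condTerms {I : Type u} {A : Condition I} {t : Term I} :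
    t ∈ condTerms A ↔ ∃ l ∈ A, t ∈ l.terms := List.mem_flatMap

theorem mem_condVars {I : Type u} {A : Condition I} {x : ℕ} : x ∈ condVars A ↔ Occurs A x := by
  simp [condVars, mem_condTerms, Term.mem_vars, Occurs]

section Primrec

variable {I : Type u} [Primcodable I] {k : ℕ}

theorem Term.primrec_vars : Primrec (Term.vars : Term I → List ℕ) :=
  (Term.primrec_casesOn (g := fun _ x => [x]) (h := fun _ _ => []) Primrec.id
    (Primrec.list_cons.comp Primrec.snd (Primrec.const [])) (Primrec.const [])).of_eq
    fun t => by cases t <;> rfl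

theorem Term.primrec_consts : Primrec (Term.consts : Term I → List (Term I)) :=
  (Term.primrec_casesOn (g := fun _ _ => []) (h := fun _ c => [Term.const c]) Primrec.id
    (Primrec.const [])
    (Primrec.list_cons.comp (Term.primrec_const.comp Primrec.snd) (Primrec.const []))).of_eq
    fun t => by cases t <;> rfl

theorem Literal.primrec_terms : Primrec (Literal.terms : Literal I → List (Term I)) :=
  (Literal.primrec_casesOn (g := fun _ a => a.args) (h := fun _ a => a.args)
    (c := fun _ o => [o.lhs, o.rhs]) Primrec.id (Atom.primrec_args.comp Primrec.snd)
    (Atom.primrec_args.comp Primrec.snd)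
    (Primrec.list_cons.comp (OrdAtom.primrec_lhs.comp Primrec.snd)
      (Primrec.list_cons.comp (OrdAtom.primrec_rhs.comp Primrec.snd) (Primrec.const [])))).of_eq
    fun l => by cases l <;> rfl

theorem primrec_condTerms : Primrec (condTerms : Condition I → List (Term I)) :=
  Primrec.list_flatMap Primrec.id (Literal.primrec_terms.comp Primrec.snd)

theorem primrec_condVars : Primrec (condVars : Condition I → List ℕ) :=
  Primrec.list_flatMap primrec_condTerms (Term.primrec_vars.comp Primrec.snd)

end Primrec

/-! ### Safety is decidable -/

/-- If `s` is a variable and `t` is a constant or a variable in `S`, then `s` belongs to `S`. -/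
def EqClosed {I : Type u} (S : List ℕ) (s t : Term I) : Prop :=
  ∀ x ∈ s.vars, (∀ y ∈ t.vars, y ∈ S) → x ∈ S

/-- The rules defining limited variables do not lead out of `S` when applied to a literal. -/
def LimitClosed {I : Type u} (S : List ℕ) : Literal I → Prop
  | .pos a => ∀ x ∈ a.args.flatMap Term.vars, x ∈ S
  | .neg _ => True
  | .cmp o => o.rel = .eq → EqClosed S o.lhs o.rhs ∧ EqClosed S o.rhs o.lhs

theorem Limited.occurs {I : Type u} {A : Condition I} {x : ℕ} (h : Limited A x) : Occurs A x := by
  have key : ∀ {t}, Equates A (.var x) t → Occurs A x := by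
    rintro t (h | h)
    · exact ⟨_, h, by simp [Literal.terms]⟩
    · exact ⟨_, h, by simp [Literal.terms]⟩
  cases h with
  | atom ha hx => exact ⟨_, ha, hx⟩
  | eqConst h => exact key h
  | eqVar _ h => exact key h

theorem Limited.mem_of_limitClosed {I : Type u} {A : Condition I} {S : List ℕ}
    (hS : ∀ l ∈ A, LimitClosed S l) {x : ℕ} (h : Limited A x) : x ∈ S := by
  have key : ∀ {s t : Term I}, Equates A s t → EqClosed S s t := by
    rintro s t (h | h)
    · exact (hS _ h rfl).1
    · exact (hS _ h rfl).2
  induction h with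
  | atom ha hx => exact hS _ ha _ (List.mem_flatMap.2 ⟨_, hx, by simp [Term.vars]⟩)
  | eqConst h => exact key h _ (by simp [Term.vars]) (by simp [Term.vars])
  | eqVar _ h ih => exact key h _ (by simp [Term.vars]) (by simpa [Term.vars] using ih)

/-- The limited variables form the least set closed under the defining rules, so a variable is
limited iff it lies in every closed set. Only the finitely many sublists of the variables of the
condition need testing, which replaces the inductive definition by bounded quantifiers. -/
theorem safe_iff {I : Type u} {A : Condition I} :
    Safe A ↔ ∀ S ∈ (condVars A).sublists', (∀ l ∈ A, LimitClosed S l) →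
      ∀ x ∈ condVars A, x ∈ S := by
  classical
  constructor
  · intro h S _ hS x hx
    exact (h x (mem_condVars.1 hx)).mem_of_limitClosed hS
  · intro h x hx
    -- The sublist of the limited variables is itself closed, so the hypothesis applies to it.
    have hmem : ∀ {y}, y ∈ (condVars A).filter (Limited A ·) ↔ Limited A y := by
      intro y
      simp only [List.mem_filter, decide_eq_true_eq, and_iff_right_iff_imp, mem_condVars]
      exact Limited.occurs
    refine hmem.1 (h _ (List.mem_sublists'.2 List.filter_sublist) ?_ x (mem_condVars.2 hx))
    have key : ∀ {s t : Term I}, Equates A s t →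
        EqClosed ((condVars A).filter (Limited A ·)) s t := by
      intro s t h y hy ht
      rw [Term.mem_vars] at hy
      subst hy
      rw [hmem]
      cases t with
      | const c => exact .eqConst h
      | var z => exact .eqVar (hmem.1 (ht z (by simp [Term.vars]))) h
    rintro (a | a | ⟨s, r, t⟩) hl
    · intro y hy
      obtain ⟨t, ht, hy⟩ := List.mem_flatMap.1 hy
      rw [Term.mem_vars] at hy
      subst hy
      exact hmem.2 (.atom hl ht)
    · trivial
    · rintro ⟨⟩
      exact ⟨key (.inl hl), key (.inr hl)⟩

section Primrec

variable {I : Type u} [Primcodable I] {k : ℕ}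

theorem primrecPred_eqClosed :
    PrimrecPred fun x : List ℕ × Term I × Term I => EqClosed x.1 x.2.1 x.2.2 := by
  refine PrimrecPred.ball (p := fun (x : List ℕ × Term I × Term I) y =>
      (∀ z ∈ x.2.2.vars, z ∈ x.1) → y ∈ x.1)
    (Term.primrec_vars.comp (Primrec.fst.comp Primrec.snd)) ?_
  refine PrimrecPred.imp ?_ (PrimrecPred.list_mem Primrec.snd (Primrec.fst.comp Primrec.fst))
  exact PrimrecPred.ball (p := fun (x : (List ℕ × Term I × Term I) × ℕ) z => z ∈ x.1.1)
    (Term.primrec_vars.comp (Primrec.snd.comp (Primrec.snd.comp Primrec.fst)))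
    (PrimrecPred.list_mem Primrec.snd (Primrec.fst.comp (Primrec.fst.comp Primrec.fst)))

theorem primrecRel_limitClosed :
    PrimrecRel (LimitClosed : List ℕ → Literal I → Prop) := by
  have hl : Primrec fun x : (List ℕ × Literal I) × OrdAtom I => x.2.lhs :=
    OrdAtom.primrec_lhs.comp Primrec.snd
  have hr : Primrec fun x : (List ℕ × Literal I) × OrdAtom I => x.2.rhs :=
    OrdAtom.primrec_rhs.comp Primrec.snd
  have hS : Primrec fun x : (List ℕ × Literal I) × OrdAtom I => x.1.1 :=
    Primrec.fst.comp Primrec.fst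
  refine (Literal.primrecPred_casesOn (f := fun x : List ℕ × Literal I => x.2)
    (g := fun x a => ∀ y ∈ a.args.flatMap Term.vars, y ∈ x.1) (h := fun _ _ => True)
    (c := fun x o => o.rel = .eq → EqClosed x.1 o.lhs o.rhs ∧ EqClosed x.1 o.rhs o.lhs)
    Primrec.snd ?_ ⟨inferInstance, Primrec.const _⟩ ?_).of_eq ?_
  · exact PrimrecPred.ball (p := fun (x : (List ℕ × Literal I) × Atom I) y => y ∈ x.1.1)
      (Primrec.list_flatMap (Atom.primrec_args.comp Primrec.snd)
        (Term.primrec_vars.comp Primrec.snd))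
      (PrimrecPred.list_mem Primrec.snd (Primrec.fst.comp (Primrec.fst.comp Primrec.fst)))
  · exact PrimrecPred.imp
      (Primrec.eq.comp (OrdAtom.primrec_rel.comp Primrec.snd) (Primrec.const _))
      ((primrecPred_eqClosed.comp (hS.pair (hl.pair hr))).and
        (primrecPred_eqClosed.comp (hS.pair (hr.pair hl))))
  · rintro ⟨S, _ | _ | _⟩ <;> rfl

theorem primrecPred_safe : PrimrecPred (Safe : Condition I → Prop) := by
  refine PrimrecPred.of_eq (p := fun A : Condition I => ∀ S ∈ (condVars A).sublists',
    (∀ l ∈ A, LimitClosed S l) → ∀ x ∈ condVars A, x ∈ S) ?_ fun A => safe_iff.symm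
  refine PrimrecPred.ball (p := fun (A : Condition I) S =>
    (∀ l ∈ A, LimitClosed S l) → ∀ x ∈ condVars A, x ∈ S)
    (Primrec.list_sublists'.comp primrec_condVars) (PrimrecPred.imp ?_ ?_)
  · exact PrimrecPred.ball (p := fun (x : Condition I × List ℕ) l => LimitClosed x.2 l)
      Primrec.fst (primrecRel_limitClosed.comp (Primrec.snd.comp Primrec.fst) Primrec.snd)
  · exact PrimrecPred.ball (p := fun (x : Condition I × List ℕ) y => y ∈ x.2)
      (primrec_condVars.comp Primrec.fst)
      (PrimrecPred.list_mem Primrec.snd (Primrec.snd.comp Primrec.fst))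

theorem Query.primrecPred_isDisjunctive :
    PrimrecPred (Query.IsDisjunctive : Query I k → Prop) := by
  refine PrimrecPred.of_eq (p := fun q : Query I k => ∀ A ∈ q.body, Safe A ∧
    (∀ x ∈ q.group, x ∈ condVars A) ∧ ∀ x ∈ List.ofFn q.agg, x ∈ condVars A) ?_ fun q => ?_
  · refine PrimrecPred.ball (p := fun (q : Query I k) A => Safe A ∧
      (∀ x ∈ q.group, x ∈ condVars A) ∧ ∀ x ∈ List.ofFn q.agg, x ∈ condVars A)
      Query.primrec_body ((primrecPred_safe.comp Primrec.snd).and (PrimrecPred.and ?_ ?_))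
    · exact PrimrecPred.ball (p := fun (x : Query I k × Condition I) y => y ∈ condVars x.2)
        (Query.primrec_group.comp Primrec.fst)
        (PrimrecPred.list_mem Primrec.snd
          (primrec_condVars.comp (Primrec.snd.comp Primrec.fst)))
    · exact PrimrecPred.ball (p := fun (x : Query I k × Condition I) y => y ∈ condVars x.2)
        (Primrec.list_ofFn fun j => Primrec.fin_app.comp (Query.primrec_agg.comp Primrec.fst)
          (Primrec.const j))
        (PrimrecPred.list_mem Primrec.snd
          (primrec_condVars.comp (Primrec.snd.comp Primrec.fst)))
  · simp only [mem_condVars, List.mem_ofFn, Query.IsDisjunctive, forall_exists_index,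
      forall_apply_eq_imp_iff]

theorem Query.primrecPred_positive :
    PrimrecPred fun q : Query I k => ∀ A ∈ q.body, ∀ a : Atom I, Literal.neg a ∉ A := by
  refine PrimrecPred.of_eq (p := fun q : Query I k => ∀ A ∈ q.body, ∀ l ∈ A,
    Literal.casesOn (motive := fun _ => Prop) l (fun _ => True) (fun _ => False)
      fun _ => True) ?_ fun q => ?_
  · refine PrimrecPred.ball (p := fun (_ : Query I k) (A : Condition I) => ∀ l ∈ A,
      Literal.casesOn (motive := fun _ => Prop) l (fun _ => True) (fun _ => False)
        fun _ => True) Query.primrec_body ?_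
    refine PrimrecPred.ball (p := fun (_ : Query I k × Condition I) l =>
      Literal.casesOn (motive := fun _ => Prop) l (fun _ => True) (fun _ => False)
        fun _ => True) Primrec.snd ?_
    exact Literal.primrecPred_casesOn (g := fun _ _ => True) (h := fun _ _ => False)
      (c := fun _ _ => True) Primrec.snd ⟨inferInstance, Primrec.const _⟩
      ⟨inferInstance, Primrec.const _⟩ ⟨inferInstance, Primrec.const _⟩
  · refine forall₂_congr fun A _ => ⟨fun h a ha => h _ ha, fun h l hl => ?_⟩
    cases l with
    | neg a => exact h a hl
    | _ => trivial

end Primrec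

/-- Bounded equivalence of positive queries reduces to bounded equivalence of all queries. -/
theorem boundedEquivalenceDecidable_positive {I : Type u} [LinearOrder I] [Nonempty I]
    [Primcodable I] {β : Type v} {k : ℕ} {α : Multiset (Fin k → I) → β}
    (h : BoundedEquivalenceDecidable α Query.IsDisjunctive) :
    BoundedEquivalenceDecidable α Query.IsPositiveDisjunctive := by
  have hp := (Query.primrecPred_positive (I := I) (k := k)).computablePred
  refine ((ComputablePred.and h (hp.comp (Computable.fst.comp Computable.snd))).and
    (hp.comp (Computable.snd.comp Computable.snd))).of_eq fun i => ?_
  simp only [Query.IsPositiveDisjunctive]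
  tauto

/-! ### Symbolic evaluation of queries -/

section Symbolic

variable {I : Type u} {k : ℕ}

/-- The value of the variable `x` under the assignment that maps the `i`-th entry of `X` to the
`i`-th entry of `σ`. -/
def symVar (X : List ℕ) (σ : List (Term I)) (x : ℕ) : Term I := σ.getD (X.idxOf x) (.var 0)

/-- Substitution of an assignment of terms to variables. -/
def Term.subst (X : List ℕ) (σ : List (Term I)) : Term I → Term I
  | .var x => symVar X σ x
  | .const c => .const c

/-- Satisfaction of a literal in the symbolic database `E` whose terms are ordered by `L`. -/
def Literal.SymSat (L : List (OrdAtom I)) (E : List (ℕ × List (Term I))) (X : List ℕ)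
    (σ : List (Term I)) : Literal I → Prop
  | .pos a => (a.pred, a.args.map (Term.subst X σ)) ∈ E
  | .neg a => (a.pred, a.args.map (Term.subst X σ)) ∉ E
  | .cmp o => (⟨o.lhs.subst X σ, o.rel, o.rhs.subst X σ⟩ : OrdAtom I) ∈ L

open Classical in
/-- The bag that a condition collects over a symbolic database with terms from `T`. -/
noncomputable def symCondBag (T : List (Term I)) (L : List (OrdAtom I))
    (E : List (ℕ × List (Term I))) (xs : List ℕ) (ys : Fin k → ℕ) (d : List (Term I))
    (A : Condition I) : List (Fin k → Term I) :=
  ((listsOf T (condVars A).dedup.length).filter fun σ =>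
    (∀ l ∈ A, l.SymSat L E (condVars A).dedup σ) ∧ xs.map (symVar (condVars A).dedup σ) = d).map
      fun σ j => symVar (condVars A).dedup σ (ys j)

/-- The bag that a query collects over a symbolic database with terms from `T`. -/
noncomputable def symBag (T : List (Term I)) (L : List (OrdAtom I))
    (E : List (ℕ × List (Term I))) (q : Query I k) (d : List (Term I)) : List (Fin k → Term I) :=
  q.body.flatMap (symCondBag T L E q.group q.agg d)

/-- The predicate symbol of a relational literal. -/
def Literal.sig : Literal I → List (ℕ × ℕ)
  | .pos a => [(a.pred, a.args.length)]
  | .neg a => [(a.pred, a.args.length)]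
  | .cmp _ => []

/-- The predicate symbols of a query. -/
def Query.sig (q : Query I k) : List (ℕ × ℕ) := q.body.flatMap fun A => A.flatMap Literal.sig

/-- The constants of a query, as terms. -/
def Query.consts (q : Query I k) : List (Term I) :=
  q.body.flatMap fun A => (condTerms A).flatMap Term.consts

theorem symVar_map {X : List ℕ} (f : ℕ → Term I) {x : ℕ} (hx : x ∈ X) :
    symVar X (X.map f) x = f x := by
  have hi : X.idxOf x < X.length := List.idxOf_lt_length_of_mem hx
  rw [symVar, List.getD_eq_getElem _ _ (by simpa using hi), List.getElem_map, List.getElem_idxOf]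

theorem symVar_mem {X : List ℕ} {T σ : List (Term I)} (hσ : σ ∈ listsOf T X.length) {x : ℕ}
    (hx : x ∈ X) : symVar X σ x ∈ T := by
  obtain ⟨hlen, hmem⟩ := mem_listsOf.1 hσ
  have hi : X.idxOf x < σ.length := hlen ▸ List.idxOf_lt_length_of_mem hx
  rw [symVar, List.getD_eq_getElem _ _ hi]
  exact hmem _ (List.getElem_mem hi)

/-- The assignment of elements given by a symbolic assignment, extended by a fixed value. -/
noncomputable def groundAssignment [Nonempty I] (δ : ℕ → I) (X : List ℕ) (σ : List (Term I)) (x : ℕ) : I :=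
  if x ∈ X then (symVar X σ x).eval δ else Classical.arbitrary I

/-- Including the constants of the condition in `T` keeps all substituted terms inside `T`, where
`L` and `E` settle every literal. -/
theorem subst_mem_and_eval [Nonempty I] {δ : ℕ → I} {T : List (Term I)} {A : Condition I}
    (hc : ∀ t ∈ (condTerms A).flatMap Term.consts, t ∈ T)
    {σ : List (Term I)} (hσ : σ ∈ listsOf T (condVars A).dedup.length) {t : Term I}
    (ht : t ∈ condTerms A) :
    t.subst (condVars A).dedup σ ∈ T ∧ (t.subst (condVars A).dedup σ).eval δ =
      t.eval (groundAssignment δ (condVars A).dedup σ) := by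
  cases t with
  | const c => exact ⟨hc _ (List.mem_flatMap.2 ⟨_, ht, by simp [Term.consts, Term.subst]⟩), rfl⟩
  | var x =>
    have hx : x ∈ (condVars A).dedup :=
      List.mem_dedup.2 (List.mem_flatMap.2 ⟨_, ht, by simp [Term.vars]⟩)
    exact ⟨symVar_mem hσ hx, by simp only [Term.eval, groundAssignment, if_pos hx]; rfl⟩

end Symbolic

/-! ### Correctness of symbolic evaluation -/

section Semantics

variable {I : Type u} [LinearOrder I] {k : ℕ}

/-- The assignment `δ` interprets the terms `T` by distinct elements ordered as `L` says, and they
include the carrier of `D`. -/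
structure Interprets (δ : ℕ → I) (T : List (Term I)) (L : List (OrdAtom I)) (D : Database I) :
    Prop where
  inj : ∀ s ∈ T, ∀ t ∈ T, s.eval δ = t.eval δ → s = t
  ord : ∀ s ∈ T, ∀ t ∈ T, ∀ r, (⟨s, r, t⟩ : OrdAtom I) ∈ L ↔ r.Holds (s.eval δ) (t.eval δ)
  cover : ∀ c ∈ carrier D, ∃ t ∈ T, t.eval δ = c

/-- On the predicate symbols in `S` and the terms `T`, the symbolic database `E` is instantiated
to `D` by `δ`. -/
def Instantiates (δ : ℕ → I) (T : List (Term I)) (S : List (ℕ × ℕ))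
    (E : List (ℕ × List (Term I))) (D : Database I) : Prop :=
  ∀ p : ℕ, ∀ l : List (Term I), (p, l.length) ∈ S → (∀ t ∈ l, t ∈ T) →
    ((p, l) ∈ E ↔ (p, l.map (Term.eval δ)) ∈ D)

variable {δ : ℕ → I} {T : List (Term I)} {L : List (OrdAtom I)} {D : Database I}
  {E : List (ℕ × List (Term I))} {A : Condition I}

theorem Interprets.list_inj (h : Interprets δ T L D) {l l' : List (Term I)} (hl : ∀ t ∈ l, t ∈ T)
    (hl' : ∀ t ∈ l', t ∈ T) : l.map (Term.eval δ) = l'.map (Term.eval δ) ↔ l = l' := by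
  refine ⟨fun e => ?_, fun e => by rw [e]⟩
  induction l generalizing l' with
  | nil => cases l' <;> simp_all
  | cons a l ih =>
    cases l' with
    | nil => simp at e
    | cons b l' =>
      simp only [List.map_cons, List.cons.injEq] at e
      rw [h.inj a (hl a (by simp)) b (hl' b (by simp)) e.1,
        ih (fun t ht => hl t (by simp [ht])) (fun t ht => hl' t (by simp [ht])) e.2]

/-- The values of a satisfying assignment are values of terms from `T`. -/
theorem Interprets.exists_term [Nonempty I] (h : Interprets δ T L D) (hA : Safe A)
    (hc : ∀ t ∈ (condTerms A).flatMap Term.consts, t ∈ T) {γ : ℕ → I}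
    (hγ : γ ∈ satAssignments A D) {x : ℕ} (hx : Occurs A x) : ∃ t ∈ T, t.eval δ = γ x := by
  have hlim := hA x hx
  clear hx
  have hconst : ∀ {l : Literal I} {c : I}, l ∈ A → Term.const c ∈ l.terms → Term.const c ∈ T :=
    fun hl hcl => hc _ (List.mem_flatMap.2 ⟨_, mem_condTerms.2 ⟨_, hl, hcl⟩, by
      simp [Term.consts]⟩)
  induction hlim with
  | @atom a x ha hx =>
    have := hγ.2 _ ha
    refine h.cover _ (Finset.mem_biUnion.2 ⟨_, this, ?_⟩)
    simp only [List.mem_toFinset, List.mem_map]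
    exact ⟨_, hx, rfl⟩
  | @eqConst x c hxc =>
    refine ⟨.const c, ?_, ?_⟩
    · rcases hxc with e | e <;> exact hconst e (by simp [Literal.terms])
    · rcases hxc with e | e
      · exact (show γ x = c from hγ.2 _ e).symm
      · exact hγ.2 _ e
  | @eqVar x y _ hxy ih =>
    have e : γ x = γ y := by
      rcases hxy with e | e
      · exact hγ.2 _ e
      · exact (show γ y = γ x from hγ.2 _ e).symm
    rwa [e]

variable [Nonempty I]

/-- Different terms of `T` denote different elements, so no real assignment is counted twice. This
preserves multiplicities. -/
theorem groundAssignment_injOn (h : Interprets δ T L D) {X : List ℕ} (hX : X.Nodup)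
    {σ τ : List (Term I)} (hσ : σ ∈ listsOf T X.length) (hτ : τ ∈ listsOf T X.length)
    (e : groundAssignment δ X σ = groundAssignment δ X τ) : σ = τ := by
  obtain ⟨hσl, hσm⟩ := mem_listsOf.1 hσ
  obtain ⟨hτl, hτm⟩ := mem_listsOf.1 hτ
  refine List.ext_getElem (by rw [hσl, hτl]) fun i h₁ h₂ => ?_
  have hi : i < X.length := hσl ▸ h₁
  have := congrFun e X[i]
  simp only [groundAssignment, List.getElem_mem, if_true, symVar] at this
  rw [hX.idxOf_getElem i hi, List.getD_eq_getElem _ _ h₁, List.getD_eq_getElem _ _ h₂] at this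
  exact h.inj _ (hσm _ (List.getElem_mem h₁)) _ (hτm _ (List.getElem_mem h₂)) this

/-- Safety enters here: every value of a satisfying assignment is named by a term of `T`. Together
with injectivity, symbolic and real satisfying assignments correspond one to one. -/
theorem exists_groundAssignment (h : Interprets δ T L D) (hA : Safe A)
    (hc : ∀ t ∈ (condTerms A).flatMap Term.consts, t ∈ T) {γ : ℕ → I}
    (hγ : γ ∈ satAssignments A D) : ∃ σ ∈ listsOf T (condVars A).dedup.length,
      groundAssignment δ (condVars A).dedup σ = γ := by
  have hX : ∀ x, x ∈ (condVars A).dedup ↔ Occurs A x := fun x => by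
    rw [List.mem_dedup, mem_condVars]
  have : ∀ x, ∃ t : Term I, Occurs A x → t ∈ T ∧ t.eval δ = γ x := fun x => by
    by_cases hx : Occurs A x
    · obtain ⟨t, ht⟩ := h.exists_term hA hc hγ hx
      exact ⟨t, fun _ => ht⟩
    · exact ⟨.var 0, fun h => absurd h hx⟩
  choose f hf using this
  refine ⟨(condVars A).dedup.map f, mem_listsOf.2 ⟨by simp, ?_⟩, funext fun x => ?_⟩
  · simp only [List.mem_map]
    rintro _ ⟨x, hx, rfl⟩
    exact (hf x ((hX x).1 hx)).1
  · rw [groundAssignment]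
    split_ifs with hx
    · rw [symVar_map f hx, (hf x ((hX x).1 hx)).2]
    · exact (hγ.1 x fun h => hx ((hX x).2 h)).symm

theorem symSat_iff (h : Interprets δ T L D) (hE : Instantiates δ T (A.flatMap Literal.sig) E D)
    (hc : ∀ t ∈ (condTerms A).flatMap Term.consts, t ∈ T) {σ : List (Term I)}
    (hσ : σ ∈ listsOf T (condVars A).dedup.length) {l : Literal I} (hl : l ∈ A) :
    l.SymSat L E (condVars A).dedup σ ↔
      l.Sat D (groundAssignment δ (condVars A).dedup σ) := by
  have hterm := fun {t} ht => subst_mem_and_eval (δ := δ) hc hσ (t := t)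
    (mem_condTerms.2 ⟨l, hl, ht⟩)
  have key : ∀ a : Atom I, a.args = l.terms → (a.pred, a.args.length) ∈ l.sig →
      ((a.pred, a.args.map (Term.subst (condVars A).dedup σ)) ∈ E ↔
        (a.pred, a.args.map (Term.eval (groundAssignment δ (condVars A).dedup σ))) ∈ D) := by
    intro a ha hs
    rw [hE a.pred _ (by simpa using List.mem_flatMap.2 ⟨l, hl, hs⟩), List.map_map]
    · rw [List.map_congr_left fun t ht => ?_]
      exact (hterm (ha ▸ ht)).2
    · simp only [List.mem_map]
      rintro _ ⟨t, ht, rfl⟩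
      exact (hterm (ha ▸ ht)).1
  cases l with
  | pos a => exact key a rfl (by simp [Literal.sig])
  | neg a => exact not_congr (key a rfl (by simp [Literal.sig]))
  | cmp o =>
    have h₁ := hterm (t := o.lhs) (by simp [Literal.terms])
    have h₂ := hterm (t := o.rhs) (by simp [Literal.terms])
    show _ ∈ L ↔ o.rel.Holds _ _
    rw [h.ord _ h₁.1 _ h₂.1, h₁.2, h₂.2]

/-- Grounding is a bijection from the symbolic satisfying assignments to the real ones, and it
respects the group and the aggregated tuple. -/
theorem conditionBag_eq_instBag (h : Interprets δ T L D) (hT : T.Nodup)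
    (hE : Instantiates δ T (A.flatMap Literal.sig) E D)
    (hc : ∀ t ∈ (condTerms A).flatMap Term.consts, t ∈ T) (hA : Safe A) {xs : List ℕ}
    (hxs : ∀ x ∈ xs, Occurs A x) {ys : Fin k → ℕ} (hys : ∀ j, Occurs A (ys j))
    {d : List (Term I)} (hd : ∀ t ∈ d, t ∈ T) :
    conditionBag A D xs ys (d.map (Term.eval δ)) = instBag δ (symCondBag T L E xs ys d A) := by
  classical
  have hX : ∀ x, x ∈ (condVars A).dedup ↔ Occurs A x := fun x => by
    rw [List.mem_dedup, mem_condVars]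
  have hfin : {γ ∈ satAssignments A D | xs.map γ = d.map (Term.eval δ)}.Finite :=
    (satAssignments_finite hA D).subset fun γ hγ => hγ.1
  have hxs' : ∀ σ ∈ listsOf T (condVars A).dedup.length,
      (xs.map (symVar (condVars A).dedup σ) = d ↔
        xs.map (groundAssignment δ (condVars A).dedup σ) = d.map (Term.eval δ)) := by
    intro σ hσ
    rw [← h.list_inj _ hd, List.map_map]
    · rw [List.map_congr_left fun x hx => ?_]
      exact (if_pos ((hX x).2 (hxs x hx))).symm
    · simp only [List.mem_map]
      rintro _ ⟨x, hx, rfl⟩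
      exact symVar_mem hσ ((hX x).2 (hxs x hx))
  -- Both sides are free of duplicates, so comparing members suffices.
  have hval : hfin.toFinset.val = (((listsOf T (condVars A).dedup.length).filter fun σ =>
      (∀ l ∈ A, l.SymSat L E (condVars A).dedup σ) ∧
        xs.map (symVar (condVars A).dedup σ) = d).map
          (groundAssignment δ (condVars A).dedup) : List (ℕ → I)) := by
    refine (Multiset.Nodup.ext hfin.toFinset.nodup ?_).2 fun γ => ?_
    · rw [Multiset.coe_nodup]
      refine List.Nodup.map_on (fun σ hσ τ hτ e => ?_) ((nodup_listsOf hT _).filter _)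
      exact groundAssignment_injOn h (List.nodup_dedup _) (List.mem_filter.1 hσ).1
        (List.mem_filter.1 hτ).1 e
    · simp only [Finset.mem_val, Set.Finite.mem_toFinset, Multiset.mem_coe, List.mem_map,
        List.mem_filter, decide_eq_true_eq]
      constructor
      · rintro ⟨hγ, hγd⟩
        obtain ⟨σ, hσ, rfl⟩ := exists_groundAssignment h hA hc hγ
        exact ⟨σ, ⟨hσ, fun l hl => (symSat_iff h hE hc hσ hl).2 (hγ.2 l hl),
          (hxs' σ hσ).2 hγd⟩, rfl⟩
      · rintro ⟨σ, ⟨hσ, hsat, hσd⟩, rfl⟩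
        refine ⟨⟨fun x hx => ?_, fun l hl => (symSat_iff h hE hc hσ hl).1 (hsat l hl)⟩,
          (hxs' σ hσ).1 hσd⟩
        exact if_neg fun h => hx ((hX x).1 h)
  rw [conditionBag, dif_pos hfin, hval, instBag, symCondBag, Multiset.map_coe, List.map_map,
    List.map_map]
  congr 2
  funext σ j
  exact if_pos ((hX _).2 (hys j))

/-- The symbolic bag does not mention `δ`: one bag of terms describes the query on all databases
obtained from `E` by models of `L`. This is what turns a statement about databases into an ordered
identity. -/
theorem Query.bag_eq_instBag (h : Interprets δ T L D) (hT : T.Nodup) {q : Query I k}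
    (hq : q.IsDisjunctive) (hE : Instantiates δ T q.sig E D) (hc : ∀ t ∈ q.consts, t ∈ T)
    {d : List (Term I)} (hd : ∀ t ∈ d, t ∈ T) :
    q.bag D (d.map (Term.eval δ)) = instBag δ (symBag T L E q d) := by
  have key : ∀ A ∈ q.body, conditionBag A D q.group q.agg (d.map (Term.eval δ)) =
      instBag δ (symCondBag T L E q.group q.agg d A) := fun A hA =>
    conditionBag_eq_instBag h hT
      (fun p l hp hl => hE p l (List.mem_flatMap.2 ⟨A, hA, hp⟩) hl)
      (fun t ht => hc t (List.mem_flatMap.2 ⟨A, hA, ht⟩)) (hq A hA).1 (hq A hA).2.1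
      (hq A hA).2.2 hd
  rw [Query.bag, symBag]
  generalize q.body = l at key ⊢
  induction l with
  | nil => rfl
  | cons A l ih =>
    rw [List.map_cons, List.sum_cons, key A (by simp), ih fun B hB => key B (by simp [hB]),
      List.flatMap_cons, instBag, instBag, instBag, List.map_append, Multiset.coe_add]

theorem Query.exists_of_bag_ne {q : Query I k} {d : List I} (hd : q.bag D d ≠ 0) :
    ∃ A ∈ q.body, ∃ γ ∈ satAssignments A D, q.group.map γ = d := by
  by_contra! hcon
  refine hd (List.sum_eq_zero fun b hb => ?_)
  obtain ⟨A, hA, rfl⟩ := List.mem_map.1 hb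
  have : {γ ∈ satAssignments A D | q.group.map γ = d} = ∅ :=
    Set.eq_empty_of_forall_notMem fun γ hγ => hcon A hA γ hγ.1 hγ.2
  simp [conditionBag, this]

/-- Groups with a nonempty bag consist of values of terms from `T`. -/
theorem Query.exists_group (h : Interprets δ T L D) {q : Query I k}
    (hq : q.IsDisjunctive) (hc : ∀ t ∈ q.consts, t ∈ T) {d : List I} (hd : q.bag D d ≠ 0) :
    ∃ e ∈ listsOf T q.group.length, e.map (Term.eval δ) = d := by
  obtain ⟨A, hA, γ, hγ, rfl⟩ := Query.exists_of_bag_ne hd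
  have hex := fun x (hx : x ∈ q.group) => h.exists_term (hq A hA).1
    (fun t ht => hc t (List.mem_flatMap.2 ⟨A, hA, ht⟩)) hγ ((hq A hA).2.1 x hx)
  have : Nonempty (Term I) := ⟨.var 0⟩
  choose! f hf using hex
  refine ⟨q.group.map f, mem_listsOf.2 ⟨by simp, ?_⟩, ?_⟩
  · simp only [List.mem_map]
    rintro _ ⟨x, hx, rfl⟩
    exact (hf x hx).1
  · rw [List.map_map]
    exact List.map_congr_left fun x hx => (hf x hx).2

end Semantics

/-! ### Reduction of bounded equivalence to ordered identities -/

section Reduction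

variable {I : Type u} {k : ℕ}

/-- The ordering predicate that holds if and only if the given one fails. -/
def OrdRel.negate : OrdRel → OrdRel
  | .lt => .ge
  | .le => .gt
  | .gt => .le
  | .ge => .lt
  | .eq => .ne
  | .ne => .eq

theorem OrdRel.holds_negate [LinearOrder I] (r : OrdRel) (a b : I) :
    r.negate.Holds a b ↔ ¬ r.Holds a b := by
  cases r <;> simp [OrdRel.negate, OrdRel.Holds]

/-- All comparisons between terms from `T`. -/
def ordAtoms (T : List (Term I)) : List (OrdAtom I) :=
  T.flatMap fun s => T.flatMap fun t =>
    [OrdRel.lt, .le, .gt, .ge, .eq, .ne].map fun r => ⟨s, r, t⟩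

theorem mem_ordAtoms {T : List (Term I)} {o : OrdAtom I} :
    o ∈ ordAtoms T ↔ o.lhs ∈ T ∧ o.rhs ∈ T := by
  obtain ⟨s, r, t⟩ := o
  have hr : r ∈ [OrdRel.lt, .le, .gt, .ge, .eq, .ne] := by cases r <;> simp
  constructor
  · intro h
    obtain ⟨s', hs, h⟩ := List.mem_flatMap.1 h
    obtain ⟨t', ht, h⟩ := List.mem_flatMap.1 h
    obtain ⟨r', -, h⟩ := List.mem_map.1 h
    cases h
    exact ⟨hs, ht⟩
  · rintro ⟨hs, ht⟩
    exact List.mem_flatMap.2 ⟨s, hs, List.mem_flatMap.2 ⟨t, ht, List.mem_map.2 ⟨r, hr, rfl⟩⟩⟩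

/-- `L` settles all comparisons between terms from `T` and makes different terms different. -/
def IsDiagram (T : List (Term I)) (L : List (OrdAtom I)) : Prop :=
  ∀ o ∈ ordAtoms T, (o ∈ L ∨ ⟨o.lhs, o.rel.negate, o.rhs⟩ ∈ L) ∧
    (o.rel = .ne → o.lhs ≠ o.rhs → o ∈ L)

open Classical in
/-- The constants of two queries and `m` variables. -/
noncomputable def symTerms (q q' : Query I k) (m : ℕ) : List (Term I) :=
  (q.consts ++ q'.consts).dedup ++ (List.range m).map .var

/-- All atoms with predicate symbols from `S` and terms from `W`. -/
def factsOver (W : List (Term I)) (S : List (ℕ × ℕ)) : List (ℕ × List (Term I)) :=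
  S.flatMap fun p => (listsOf W p.2).map fun l => (p.1, l)

theorem mem_factsOver {W : List (Term I)} {S : List (ℕ × ℕ)} {a : ℕ × List (Term I)} :
    a ∈ factsOver W S ↔ (a.1, a.2.length) ∈ S ∧ ∀ t ∈ a.2, t ∈ W := by
  obtain ⟨p, l⟩ := a
  simp only [factsOver, List.mem_flatMap, List.mem_map, mem_listsOf]
  constructor
  · rintro ⟨⟨p', n⟩, hS, l', ⟨rfl, hl⟩, h⟩
    cases h
    exact ⟨hS, hl⟩
  · rintro ⟨hS, hl⟩
    exact ⟨_, hS, l, ⟨rfl, hl⟩, rfl⟩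

theorem Query.mem_consts_iff {q : Query I k} {t : Term I} (ht : t ∈ q.consts) :
    ∃ c, t = .const c := by
  obtain ⟨A, -, ht⟩ := List.mem_flatMap.1 ht
  obtain ⟨s, -, ht⟩ := List.mem_flatMap.1 ht
  exact (Term.mem_consts.1 ht).2

theorem mem_symTerms {q q' : Query I k} {m : ℕ} {t : Term I} :
    t ∈ symTerms q q' m ↔ (t ∈ q.consts ∨ t ∈ q'.consts) ∨ ∃ i < m, t = .var i := by
  classical
  simp [symTerms, eq_comm]

theorem nodup_symTerms (q q' : Query I k) (m : ℕ) : (symTerms q q' m).Nodup := by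
  classical
  refine List.Nodup.append (List.nodup_dedup _)
    ((List.nodup_range).map fun _ _ h => by simpa using h) ?_
  intro t ht ht'
  obtain ⟨i, -, rfl⟩ := List.mem_map.1 ht'
  rw [List.mem_dedup, List.mem_append] at ht
  rcases ht with ht | ht <;> obtain ⟨c, hc⟩ := Query.mem_consts_iff ht <;> cases hc

theorem instBag_eq_zero {δ : ℕ → I} {B : List (Fin k → Term I)} :
    instBag δ B = 0 ↔ B = [] := by
  simp [instBag]

theorem forall_mem_symBag {T : List (Term I)} {L : List (OrdAtom I)}
    {E : List (ℕ × List (Term I))} {q : Query I k} (hq : q.IsDisjunctive) {d : List (Term I)} :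
    ∀ s ∈ symBag T L E q d, ∀ j, s j ∈ T := by
  intro s hs j
  obtain ⟨A, hA, hs⟩ := List.mem_flatMap.1 hs
  obtain ⟨σ, hσ, rfl⟩ := List.mem_map.1 hs
  exact symVar_mem (List.mem_filter.1 hσ).1
    (List.mem_dedup.2 (mem_condVars.2 ((hq A hA).2.2 j)))

variable [LinearOrder I] {β : Type v}

/-- An unsatisfiable `L` entails everything, contrary to "exactly one" for a term of its first atom;
an empty `L` is satisfied by any assignment. -/
theorem IsCompleteOrdering.exists_sat [Nonempty I] {L : List (OrdAtom I)} {T : List (Term I)}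
    (h : IsCompleteOrdering L T) : ∃ δ : ℕ → I, ∀ o ∈ L, o.Sat δ := by
  by_contra! hcon
  have hall : ∀ s r t, Entails L s r t := fun s r t δ hδ => by
    obtain ⟨o, ho, hn⟩ := hcon δ
    exact absurd (hδ o ho) hn
  cases L with
  | nil =>
    obtain ⟨o, ho, -⟩ := hcon fun _ => Classical.arbitrary I
    simp at ho
  | cons o L =>
    have hs := (h.1 o (by simp)).1
    rcases h.2 _ hs _ hs with h | h | h
    · exact h.2.1 (hall _ _ _)
    · exact h.1 (hall _ _ _)
    · exact h.1 (hall _ _ _)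

/-- A diagram contains each comparison over `T` or its negation, so in any model truth coincides
with membership in `L`. The atoms `≠` between different terms give injectivity. -/
theorem IsDiagram.interprets {T : List (Term I)} {L : List (OrdAtom I)} (h : IsDiagram T L)
    {δ : ℕ → I} (hδ : ∀ o ∈ L, o.Sat δ) {D : Database I}
    (hD : ∀ c ∈ carrier D, ∃ t ∈ T, t.eval δ = c) : Interprets δ T L D where
  inj s hs t ht e := by
    by_contra hne
    exact hδ _ ((h ⟨s, .ne, t⟩ (mem_ordAtoms.2 ⟨hs, ht⟩)).2 rfl hne) e
  ord s hs t ht r := by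
    refine ⟨fun ho => hδ _ ho, fun hr => ?_⟩
    refine (h ⟨s, r, t⟩ (mem_ordAtoms.2 ⟨hs, ht⟩)).1.resolve_right fun hn => ?_
    exact (OrdRel.holds_negate _ _ _).1 (hδ _ hn) hr
  cover := hD

theorem isCompleteOrdering_of_ord {δ : ℕ → I} {T : List (Term I)} {L : List (OrdAtom I)}
    (hL : ∀ o, o ∈ L ↔ (o.lhs ∈ T ∧ o.rhs ∈ T) ∧ o.Sat δ) : IsCompleteOrdering L T := by
  refine ⟨fun o ho => ((hL o).1 ho).1, fun s hs t ht => ?_⟩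
  have hδ : ∀ o ∈ L, o.Sat δ := fun o ho => ((hL o).1 ho).2
  have key : ∀ r, Entails L s r t ↔ r.Holds (s.eval δ) (t.eval δ) := fun r =>
    ⟨fun h => h δ hδ, fun h δ' hδ' => hδ' ⟨s, r, t⟩ ((hL _).2 ⟨⟨hs, ht⟩, h⟩)⟩
  simp only [key, OrdRel.Holds]
  rcases lt_trichotomy (s.eval δ) (t.eval δ) with h | h | h
  · exact .inl ⟨h, h.not_gt, h.ne⟩
  · exact .inr (.inr ⟨h.not_lt, h.not_gt, h⟩)
  · exact .inr (.inl ⟨h.not_gt, h, h.ne'⟩)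

/-- Whether the results of `q` and `q'` for the symbolic group `d` agree. -/
def SymAgree (α : Multiset (Fin k → I) → β) (T : List (Term I)) (L : List (OrdAtom I))
    (E : List (ℕ × List (Term I))) (q q' : Query I k) (d : List (Term I)) : Prop :=
  (symBag T L E q d = [] ↔ symBag T L E q' d = []) ∧
    (symBag T L E q d = [] ∨ IdentityValid α (T, L, symBag T L E q d, symBag T L E q' d))

/-- The symbolic counterpart of `N`-equivalence, with all quantifiers bounded. -/
def SymEquivalent (α : Multiset (Fin k → I) → β) (N : ℕ) (q q' : Query I k) : Prop :=
  ∀ m ∈ List.range (N + 1), ∀ L ∈ (ordAtoms (symTerms q q' m)).sublists',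
    IsCompleteOrdering L (symTerms q q' m) ∧ IsDiagram (symTerms q q' m) L →
    ∀ W ∈ (symTerms q q' m).sublists', W.length ≤ N →
    ∀ E ∈ (factsOver W (q.sig ++ q'.sig)).sublists',
    ∀ d ∈ listsOf (symTerms q q' m) q.group.length ++ listsOf (symTerms q q' m) q'.group.length,
      SymAgree α (symTerms q q' m) L E q q' d

variable [Nonempty I]

/-- An empty bag contributes no tuple, hence the separate clause on emptiness; the value of `α` at
an empty bag is compared with nothing. -/
theorem Query.result_eq_iff {α : Multiset (Fin k → I) → β} {q q' : Query I k} {D : Database I} :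
    q.result α D = q'.result α D ↔ ∀ d, (q.bag D d = 0 ↔ q'.bag D d = 0) ∧
      (q.bag D d = 0 ∨ α (q.bag D d) = α (q'.bag D d)) := by
  constructor
  · intro h d
    have h₁ := Set.ext_iff.1 h (d, α (q.bag D d))
    have h₂ := Set.ext_iff.1 h (d, α (q'.bag D d))
    simp only [Query.result, Set.mem_ofPred_eq, ne_eq, and_true] at h₁ h₂
    tauto
  · intro h
    ext ⟨d, b⟩
    simp only [Query.result, Set.mem_ofPred_eq]
    obtain ⟨h₁, h₂⟩ := h d
    rw [ne_eq, ne_eq, ← h₁]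
    refine and_congr_right fun hne => ?_
    rw [h₂.resolve_left hne]

/-- Each model `δ` of `L` turns `E` into a real database whose carrier consists of values of terms
of `W`, hence has at most `N` elements, and on which the hypothesis can be used. -/
theorem NEquivalent.symEquivalent {α : Multiset (Fin k → I) → β} {N : ℕ} {q q' : Query I k}
    (hq : q.IsDisjunctive) (hq' : q'.IsDisjunctive) (h : NEquivalent α N q q') :
    SymEquivalent α N q q' := by
  classical
  intro m _ L hL ⟨hcomp, hdiag⟩ W hW hWN E hE d hd
  set T := symTerms q q' m with hT
  have hdT : ∀ t ∈ d, t ∈ T := by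
    rcases List.mem_append.1 hd with hd | hd <;> exact (mem_listsOf.1 hd).2
  have hWT : ∀ t ∈ W, t ∈ T := fun t ht => (List.mem_sublists'.1 hW).subset ht
  have hEW : ∀ a ∈ E, ∀ t ∈ a.2, t ∈ W := fun a ha =>
    (mem_factsOver.1 ((List.mem_sublists'.1 hE).subset ha)).2
  have key : ∀ δ : ℕ → I, (∀ o ∈ L, o.Sat δ) →
      (symBag T L E q d = [] ↔ symBag T L E q' d = []) ∧
      (symBag T L E q d = [] ∨
        α (instBag δ (symBag T L E q d)) = α (instBag δ (symBag T L E q' d))) := by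
    intro δ hδ
    set D : Database I := (E.map fun a => (a.1, a.2.map (Term.eval δ))).toFinset with hDdef
    have hcar : ∀ c ∈ carrier D, ∃ t ∈ W, t.eval δ = c := by
      intro c hc
      obtain ⟨b, hb, hc⟩ := Finset.mem_biUnion.1 hc
      simp only [hDdef, List.mem_toFinset, List.mem_map] at hb
      obtain ⟨a, ha, rfl⟩ := hb
      simp only [List.mem_toFinset, List.mem_map] at hc
      obtain ⟨t, ht, rfl⟩ := hc
      exact ⟨t, hEW a ha t ht, rfl⟩
    have hint : Interprets δ T L D := hdiag.interprets hδ fun c hc => by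
      obtain ⟨t, ht, e⟩ := hcar c hc
      exact ⟨t, hWT t ht, e⟩
    have hinst : ∀ S, Instantiates δ T S E D := by
      intro S p l _ hl
      simp only [hDdef, List.mem_toFinset, List.mem_map, Prod.mk.injEq]
      constructor
      · exact fun hpl => ⟨_, hpl, rfl, rfl⟩
      · rintro ⟨⟨p', l'⟩, ha, rfl, e⟩
        rw [hint.list_inj (fun t ht => hWT t (hEW _ ha t ht)) hl] at e
        exact e ▸ ha
    have hN : (carrier D).card ≤ N := by
      refine le_trans (Finset.card_le_card (t := (W.map (Term.eval δ)).toFinset) ?_)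
        ((List.toFinset_card_le _).trans (by simpa using hWN))
      intro c hc
      obtain ⟨t, ht, e⟩ := hcar c hc
      simp only [List.mem_toFinset, List.mem_map]
      exact ⟨t, ht, e⟩
    have hres := Query.result_eq_iff.1 (h D hN) (d.map (Term.eval δ))
    rw [Query.bag_eq_instBag hint (nodup_symTerms q q' m) hq (hinst _)
      (fun t ht => mem_symTerms.2 (.inl (.inl ht))) hdT,
      Query.bag_eq_instBag hint (nodup_symTerms q q' m) hq' (hinst _)
      (fun t ht => mem_symTerms.2 (.inl (.inr ht))) hdT] at hres
    simpa only [instBag_eq_zero] using hres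
  -- Emptiness of the symbolic bags is independent of the model, so a single model settles it.
  obtain ⟨δ₀, hδ₀⟩ := hcomp.exists_sat
  refine ⟨(key δ₀ hδ₀).1, ?_⟩
  by_cases hB : symBag T L E q d = []
  · exact .inl hB
  · exact .inr fun δ hδ => (key δ hδ).2.resolve_left hB

/-- Every small database arises from symbolic data: variables name the carrier elements that are not
query constants, and `L`, `W` and `E` record what is true in it. -/
theorem SymEquivalent.nEquivalent {α : Multiset (Fin k → I) → β} {N : ℕ} {q q' : Query I k}
    (hq : q.IsDisjunctive) (hq' : q'.IsDisjunctive) (h : SymEquivalent α N q q') :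
    NEquivalent α N q q' := by
  classical
  intro D hD
  -- Query constants are left out because they already name themselves; otherwise two terms of `T`
  -- would have the same value.
  obtain ⟨K, hK⟩ : ∃ K : List I, K = ((carrier D).filter fun c =>
    ¬ (Term.const c ∈ q.consts ∨ Term.const c ∈ q'.consts)).toList := ⟨_, rfl⟩
  have hKnd : K.Nodup := hK ▸ Finset.nodup_toList _
  have hKmem : ∀ c, c ∈ K ↔ c ∈ carrier D ∧
      ¬ (Term.const c ∈ q.consts ∨ Term.const c ∈ q'.consts) := by simp [hK]
  have hKN : K.length ≤ N := by
    rw [hK, Finset.length_toList]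
    exact (Finset.card_filter_le _ _).trans hD
  obtain ⟨δ, hδK⟩ : ∃ δ : ℕ → I, ∀ i (hi : i < K.length), δ i = K[i] :=
    ⟨fun i => K.getD i (Classical.arbitrary I), fun i hi => List.getD_eq_getElem _ _ hi⟩
  set T := symTerms q q' K.length with hT
  have hcv : ∀ t, (t ∈ q.consts ∨ t ∈ q'.consts) → ∀ i < K.length, t.eval δ ≠ δ i := by
    intro t ht i hi e
    have : ∃ c, t = .const c := ht.elim Query.mem_consts_iff Query.mem_consts_iff
    obtain ⟨c, rfl⟩ := this
    have hc : c = K[i] := (hδK i hi) ▸ e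
    exact ((hKmem c).1 (hc ▸ List.getElem_mem hi)).2 ht
  have hinj : ∀ s ∈ T, ∀ t ∈ T, s.eval δ = t.eval δ → s = t := by
    intro s hs t ht e
    rcases mem_symTerms.1 hs with hs | ⟨i, hi, rfl⟩ <;>
      rcases mem_symTerms.1 ht with ht | ⟨j, hj, rfl⟩
    · obtain ⟨c, rfl⟩ : ∃ c, s = .const c := hs.elim Query.mem_consts_iff Query.mem_consts_iff
      obtain ⟨c', rfl⟩ : ∃ c, t = .const c := ht.elim Query.mem_consts_iff Query.mem_consts_iff
      exact congrArg Term.const e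
    · exact absurd e (hcv s hs j hj)
    · exact absurd e.symm (hcv t ht i hi)
    · have e : δ i = δ j := e
      rw [hδK i hi, hδK j hj] at e
      rw [hKnd.getElem_inj_iff.1 e]
  have hcover : ∀ c ∈ carrier D, ∃ t ∈ T, t.eval δ = c := by
    intro c hc
    by_cases hcc : Term.const c ∈ q.consts ∨ Term.const c ∈ q'.consts
    · exact ⟨_, mem_symTerms.2 (.inl hcc), rfl⟩
    · obtain ⟨i, hi, rfl⟩ := List.getElem_of_mem ((hKmem c).2 ⟨hc, hcc⟩)
      exact ⟨.var i, mem_symTerms.2 (.inr ⟨i, hi, rfl⟩), hδK i hi⟩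
  set L := (ordAtoms T).filter (OrdAtom.Sat δ ·) with hLdef
  have hL : ∀ o, o ∈ L ↔ (o.lhs ∈ T ∧ o.rhs ∈ T) ∧ o.Sat δ := fun o => by
    simp [hLdef, mem_ordAtoms]
  have hdiag : IsDiagram T L := by
    intro o ho
    have ho := mem_ordAtoms.1 ho
    refine ⟨?_, fun hr hne => (hL o).2 ⟨ho, ?_⟩⟩
    · by_cases hs : o.Sat δ
      · exact .inl ((hL o).2 ⟨ho, hs⟩)
      · exact .inr ((hL _).2 ⟨ho, (OrdRel.holds_negate _ _ _).2 hs⟩)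
    · rw [OrdAtom.Sat, hr]
      exact fun e => hne (hinj _ ho.1 _ ho.2 e)
  have hint : Interprets δ T L D := hdiag.interprets (fun o ho => ((hL o).1 ho).2) hcover
  -- Query constants outside the carrier belong to `T` but must not count towards the bound `N`, so
  -- the terms naming carrier elements are singled out.
  set W := T.filter (fun t => t.eval δ ∈ carrier D) with hW
  have hWN : W.length ≤ N := by
    have hnd : (W.map (Term.eval δ)).Nodup :=
      List.Nodup.map_on (fun s hs t ht => hinj s (List.mem_filter.1 hs).1 t
        (List.mem_filter.1 ht).1) ((nodup_symTerms q q' _).filter _)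
    rw [← List.length_map (f := Term.eval δ), ← List.toFinset_card_of_nodup hnd]
    refine (Finset.card_le_card fun c hc => ?_).trans hD
    simp only [hW, List.mem_toFinset, List.mem_map, List.mem_filter, decide_eq_true_eq] at hc
    obtain ⟨t, ht, rfl⟩ := hc
    exact ht.2
  set E := (factsOver W (q.sig ++ q'.sig)).filter
    (fun a => (a.1, a.2.map (Term.eval δ)) ∈ D) with hE
  -- The database may hold facts with other predicate symbols; those are invisible to both queries
  -- and absent from `E`.
  have hinst : ∀ S, S ⊆ q.sig ++ q'.sig → Instantiates δ T S E D := by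
    intro S hS p l hpl hl
    simp only [hE, List.mem_filter, mem_factsOver, decide_eq_true_eq]
    refine ⟨fun h => h.2, fun hD => ⟨⟨hS hpl, fun t ht => ?_⟩, hD⟩⟩
    refine List.mem_filter.2 ⟨hl t ht, decide_eq_true ?_⟩
    exact Finset.mem_biUnion.2 ⟨_, hD, List.mem_toFinset.2 (List.mem_map.2 ⟨t, ht, rfl⟩)⟩
  have hc : ∀ t ∈ q.consts, t ∈ T := fun t ht => mem_symTerms.2 (.inl (.inl ht))
  have hc' : ∀ t ∈ q'.consts, t ∈ T := fun t ht => mem_symTerms.2 (.inl (.inr ht))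
  have key : ∀ d ∈ listsOf T q.group.length ++ listsOf T q'.group.length,
      (q.bag D (d.map (Term.eval δ)) = 0 ↔ q'.bag D (d.map (Term.eval δ)) = 0) ∧
      (q.bag D (d.map (Term.eval δ)) = 0 ∨
        α (q.bag D (d.map (Term.eval δ))) = α (q'.bag D (d.map (Term.eval δ)))) := by
    intro d hd
    have hdT : ∀ t ∈ d, t ∈ T := by
      rcases List.mem_append.1 hd with hd | hd <;> exact (mem_listsOf.1 hd).2
    have hagree := h K.length (List.mem_range.2 (by omega)) L
      (List.mem_sublists'.2 List.filter_sublist) ⟨isCompleteOrdering_of_ord hL, hdiag⟩ W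
      (List.mem_sublists'.2 List.filter_sublist) hWN E
      (List.mem_sublists'.2 List.filter_sublist) d hd
    rw [Query.bag_eq_instBag hint (nodup_symTerms q q' _) hq
        (hinst _ (List.subset_append_left _ _)) hc hdT,
      Query.bag_eq_instBag hint (nodup_symTerms q q' _) hq'
        (hinst _ (List.subset_append_right _ _)) hc' hdT, instBag_eq_zero, instBag_eq_zero]
    exact ⟨hagree.1, hagree.2.imp_right fun hv => hv δ fun o ho => ((hL o).1 ho).2⟩
  refine Query.result_eq_iff.2 fun d => ?_
  -- A group with a nonempty bag is a tuple of values of terms of `T`, of the head length of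
  -- whichever query is nonempty on it. The two lengths may differ, which is why groups of both
  -- lengths are enumerated.
  by_cases hd : q.bag D d = 0
  · by_cases hd' : q'.bag D d = 0
    · simp [hd, hd']
    · obtain ⟨e, he, rfl⟩ := Query.exists_group hint hq' hc' hd'
      exact key e (List.mem_append_right _ he)
  · obtain ⟨e, he, rfl⟩ := Query.exists_group hint hq hc hd
    exact key e (List.mem_append_left _ he)

end Reduction

/-! ### Symbolic evaluation is primitive recursive -/

section Primrec

variable {I : Type u} [Primcodable I] {k : ℕ} {γ : Type*} [Primcodable γ]

theorem primrec_symVar {X : γ → List ℕ} {σ : γ → List (Term I)} {x : γ → ℕ} (hX : Primrec X)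
    (hσ : Primrec σ) (hx : Primrec x) : Primrec fun a => symVar (X a) (σ a) (x a) :=
  (Primrec.list_getD (Term.var 0 : Term I)).comp hσ (Primrec.list_idxOf.comp hx hX)

theorem Term.primrec_subst {X : γ → List ℕ} {σ : γ → List (Term I)} {t : γ → Term I}
    (hX : Primrec X) (hσ : Primrec σ) (ht : Primrec t) :
    Primrec fun a => (t a).subst (X a) (σ a) :=
  (Term.primrec_casesOn (g := fun a x => symVar (X a) (σ a) x) (h := fun _ c => .const c) ht
    (primrec_symVar (hX.comp Primrec.fst) (hσ.comp Primrec.fst) Primrec.snd)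
    (Term.primrec_const.comp Primrec.snd)).of_eq fun a => by cases t a <;> rfl

theorem Literal.primrecPred_symSat {L : γ → List (OrdAtom I)} {E : γ → List (ℕ × List (Term I))}
    {X : γ → List ℕ} {σ : γ → List (Term I)} {l : γ → Literal I} (hL : Primrec L)
    (hE : Primrec E) (hX : Primrec X) (hσ : Primrec σ) (hl : Primrec l) :
    PrimrecPred fun a => (l a).SymSat (L a) (E a) (X a) (σ a) := by
  have key : PrimrecRel fun (a : γ) (b : Atom I) =>
      (b.pred, b.args.map (Term.subst (X a) (σ a))) ∈ E a :=
    PrimrecPred.list_mem (f := fun y : γ × Atom I =>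
        (y.2.pred, y.2.args.map (Term.subst (X y.1) (σ y.1))))
      (Primrec.pair (Atom.primrec_pred.comp Primrec.snd)
        (Primrec.list_map (Atom.primrec_args.comp Primrec.snd)
          (Term.primrec_subst (hX.comp (Primrec.fst.comp Primrec.fst))
            (hσ.comp (Primrec.fst.comp Primrec.fst)) Primrec.snd)))
      (hE.comp Primrec.fst)
  have hcmp : PrimrecRel fun (a : γ) (o : OrdAtom I) =>
      (⟨o.lhs.subst (X a) (σ a), o.rel, o.rhs.subst (X a) (σ a)⟩ : OrdAtom I) ∈ L a :=
    PrimrecPred.list_mem (f := fun y : γ × OrdAtom I =>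
        (⟨y.2.lhs.subst (X y.1) (σ y.1), y.2.rel, y.2.rhs.subst (X y.1) (σ y.1)⟩ : OrdAtom I))
      (OrdAtom.primrec_mk
        (Term.primrec_subst (hX.comp Primrec.fst) (hσ.comp Primrec.fst)
          (OrdAtom.primrec_lhs.comp Primrec.snd))
        (OrdAtom.primrec_rel.comp Primrec.snd)
        (Term.primrec_subst (hX.comp Primrec.fst) (hσ.comp Primrec.fst)
          (OrdAtom.primrec_rhs.comp Primrec.snd)))
      (hL.comp Primrec.fst)
  refine (Literal.primrecPred_casesOn hl key key.not hcmp).of_eq fun a => ?_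
  cases l a <;> rfl

theorem primrec_symCondBag {T : γ → List (Term I)} {L : γ → List (OrdAtom I)}
    {E : γ → List (ℕ × List (Term I))} {xs : γ → List ℕ} {ys : γ → Fin k → ℕ}
    {d : γ → List (Term I)} {A : γ → Condition I} (hT : Primrec T) (hL : Primrec L)
    (hE : Primrec E) (hxs : Primrec xs) (hys : Primrec ys) (hd : Primrec d) (hA : Primrec A) :
    Primrec fun a => symCondBag (T a) (L a) (E a) (xs a) (ys a) (d a) (A a) := by
  classical
  have hX : Primrec fun a => (condVars (A a)).dedup :=
    Primrec.list_dedup.comp (primrec_condVars.comp hA)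
  refine Primrec.list_map (g := fun a σ j => symVar (condVars (A a)).dedup σ (ys a j))
    (Primrec.list_filter (p := fun a σ =>
      (∀ l ∈ A a, l.SymSat (L a) (E a) (condVars (A a)).dedup σ) ∧
        (xs a).map (symVar (condVars (A a)).dedup σ) = d a)
      (Primrec.listsOf hT (Primrec.list_length.comp hX)) (PrimrecPred.and ?_ ?_)) ?_
  · exact PrimrecPred.ball (p := fun (y : γ × List (Term I)) (l : Literal I) =>
        l.SymSat (L y.1) (E y.1) (condVars (A y.1)).dedup y.2) (hA.comp Primrec.fst)
      (Literal.primrecPred_symSat (hL.comp (Primrec.fst.comp Primrec.fst))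
        (hE.comp (Primrec.fst.comp Primrec.fst)) (hX.comp (Primrec.fst.comp Primrec.fst))
        (Primrec.snd.comp Primrec.fst) Primrec.snd)
  · exact Primrec.eq.comp (Primrec.list_map (hxs.comp Primrec.fst)
      (primrec_symVar (hX.comp (Primrec.fst.comp Primrec.fst))
        (Primrec.snd.comp Primrec.fst) Primrec.snd)) (hd.comp Primrec.fst)
  · exact Primrec.fin_curry.2 (primrec_symVar (hX.comp (Primrec.fst.comp Primrec.fst))
      (Primrec.snd.comp Primrec.fst)
      (Primrec.fin_app.comp (hys.comp (Primrec.fst.comp Primrec.fst)) Primrec.snd))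

theorem primrec_symBag {T : γ → List (Term I)} {L : γ → List (OrdAtom I)}
    {E : γ → List (ℕ × List (Term I))} {q : γ → Query I k} {d : γ → List (Term I)}
    (hT : Primrec T) (hL : Primrec L) (hE : Primrec E) (hq : Primrec q) (hd : Primrec d) :
    Primrec fun a => symBag (T a) (L a) (E a) (q a) (d a) :=
  Primrec.list_flatMap (Query.primrec_body.comp hq)
    (primrec_symCondBag (hT.comp Primrec.fst) (hL.comp Primrec.fst) (hE.comp Primrec.fst)
      (Query.primrec_group.comp (hq.comp Primrec.fst))
      (Query.primrec_agg.comp (hq.comp Primrec.fst)) (hd.comp Primrec.fst) Primrec.snd)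

theorem Literal.primrec_sig : Primrec (Literal.sig : Literal I → List (ℕ × ℕ)) := by
  have h : Primrec₂ fun (_ : Literal I) (a : Atom I) => [(a.pred, a.args.length)] :=
    Primrec.list_cons.comp ((Atom.primrec_pred.comp Primrec.snd).pair
      (Primrec.list_length.comp (Atom.primrec_args.comp Primrec.snd))) (Primrec.const [])
  refine (Literal.primrec_casesOn (c := fun _ _ => []) Primrec.id h h
    (Primrec.const [])).of_eq fun l => ?_
  cases l <;> rfl

theorem Query.primrec_sig : Primrec (Query.sig : Query I k → List (ℕ × ℕ)) :=
  Primrec.list_flatMap Query.primrec_body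
    (Primrec.list_flatMap Primrec.snd (Literal.primrec_sig.comp Primrec.snd))

theorem Query.primrec_consts : Primrec (Query.consts : Query I k → List (Term I)) :=
  Primrec.list_flatMap Query.primrec_body
    (Primrec.list_flatMap (primrec_condTerms.comp Primrec.snd)
      (Term.primrec_consts.comp Primrec.snd))

theorem primrec_symTerms {q q' : γ → Query I k} {m : γ → ℕ} (hq : Primrec q) (hq' : Primrec q')
    (hm : Primrec m) : Primrec fun a => symTerms (q a) (q' a) (m a) := by
  classical
  exact Primrec.list_append.comp
    (Primrec.list_dedup.comp (Primrec.list_append.comp (Query.primrec_consts.comp hq)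
      (Query.primrec_consts.comp hq')))
    (Primrec.list_map (Primrec.list_range.comp hm) (Term.primrec_var.comp Primrec.snd))

theorem primrec_ordAtoms : Primrec (ordAtoms : List (Term I) → List (OrdAtom I)) :=
  Primrec.list_flatMap Primrec.id <| Primrec.list_flatMap Primrec.fst <|
    Primrec.list_map (Primrec.const _) <|
      OrdAtom.primrec_mk (Primrec.snd.comp (Primrec.fst.comp Primrec.fst))
        Primrec.snd (Primrec.snd.comp Primrec.fst)

theorem primrec_factsOver {W : γ → List (Term I)} {S : γ → List (ℕ × ℕ)} (hW : Primrec W)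
    (hS : Primrec S) : Primrec fun a => factsOver (W a) (S a) :=
  Primrec.list_flatMap hS <|
    Primrec.list_map (Primrec.listsOf (hW.comp Primrec.fst) (Primrec.snd.comp Primrec.snd)) <|
      Primrec.pair (Primrec.fst.comp (Primrec.snd.comp Primrec.fst)) Primrec.snd

theorem primrecPred_isDiagram {T : γ → List (Term I)} {L : γ → List (OrdAtom I)}
    (hT : Primrec T) (hL : Primrec L) : PrimrecPred fun a => IsDiagram (T a) (L a) := by
  have hL' : Primrec fun x : γ × OrdAtom I => L x.1 := hL.comp Primrec.fst
  have hl : Primrec fun x : γ × OrdAtom I => x.2.lhs := OrdAtom.primrec_lhs.comp Primrec.snd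
  have hr : Primrec fun x : γ × OrdAtom I => x.2.rhs := OrdAtom.primrec_rhs.comp Primrec.snd
  have hrel : Primrec fun x : γ × OrdAtom I => x.2.rel := OrdAtom.primrec_rel.comp Primrec.snd
  refine PrimrecPred.ball (p := fun a (o : OrdAtom I) =>
    (o ∈ L a ∨ ⟨o.lhs, o.rel.negate, o.rhs⟩ ∈ L a) ∧ (o.rel = .ne → o.lhs ≠ o.rhs → o ∈ L a))
    (primrec_ordAtoms.comp hT) ?_
  refine PrimrecPred.and (PrimrecPred.or (PrimrecPred.list_mem Primrec.snd hL') ?_) ?_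
  · exact PrimrecPred.list_mem
      (OrdAtom.primrec_mk hl ((Primrec.dom_finite OrdRel.negate).comp hrel) hr) hL'
  · exact (Primrec.eq.comp hrel (Primrec.const _)).imp
      ((Primrec.eq.comp hl hr).not.imp (PrimrecPred.list_mem Primrec.snd hL'))

end Primrec

/-! ### Order-decidability implies decidability of bounded equivalence -/

/-- With two empty bags the identity is trivially valid, so the decision procedure reports exactly
whether `L` is a complete ordering. The order of `I` is not assumed computable and is accessed only
in this way. -/
theorem OrderDecidable.isCompleteOrdering {I : Type u} [LinearOrder I] [Primcodable I]
    {β : Type v} {k : ℕ} {α : Multiset (Fin k → I) → β} (h : OrderDecidable α) :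
    ComputablePred fun x : List (OrdAtom I) × List (Term I) => IsCompleteOrdering x.1 x.2 := by
  refine (ComputablePred.comp h (f := fun x : List (OrdAtom I) × List (Term I) =>
    (x.2, x.1, [], [])) ?_).of_eq fun x => ?_
  · exact (Primrec.snd.pair (Primrec.fst.pair ((Primrec.const []).pair
      (Primrec.const [])))).to_comp
  · simp [IsOrderedIdentity, IdentityValid]

theorem OrderDecidable.symEquivalent {I : Type u} [LinearOrder I] [Nonempty I] [Primcodable I]
    {β : Type v} {k : ℕ} {α : Multiset (Fin k → I) → β} (h : OrderDecidable α) :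
    ComputablePred fun i : ℕ × Query I k × Query I k =>
      i.2.1.IsDisjunctive ∧ i.2.2.IsDisjunctive ∧ SymEquivalent α i.1 i.2.1 i.2.2 := by
  -- These are the contexts of the nested bounded quantifiers, extended in turn by `m`, `L`, `W`,
  -- `E` and the group.
  let Γ₁ := (ℕ × Query I k × Query I k) × ℕ
  let Γ₂ := Γ₁ × List (OrdAtom I)
  let Γ₃ := Γ₂ × List (Term I)
  let Γ₄ := Γ₃ × List (ℕ × List (Term I))
  let Γ₅ := Γ₄ × List (Term I)
  have hdisj := (Query.primrecPred_isDisjunctive (I := I) (k := k)).computablePred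
  have hT₁ : Primrec fun x : Γ₁ => symTerms x.1.2.1 x.1.2.2 x.2 :=
    primrec_symTerms (Primrec.fst.comp (Primrec.snd.comp Primrec.fst))
      (Primrec.snd.comp (Primrec.snd.comp Primrec.fst)) Primrec.snd
  have hq₃ : Primrec fun x : Γ₃ => x.1.1.1.2 :=
    Primrec.snd.comp (Primrec.fst.comp (Primrec.fst.comp Primrec.fst))
  have hT₄ : Primrec fun x : Γ₄ => symTerms x.1.1.1.1.2.1 x.1.1.1.1.2.2 x.1.1.1.2 :=
    hT₁.comp (Primrec.fst.comp (Primrec.fst.comp Primrec.fst))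
  have hT₅ : Primrec fun x : Γ₅ => symTerms x.1.1.1.1.1.2.1 x.1.1.1.1.1.2.2 x.1.1.1.1.2 :=
    hT₄.comp Primrec.fst
  have hL₅ : Primrec fun x : Γ₅ => x.1.1.1.2 :=
    Primrec.snd.comp (Primrec.fst.comp (Primrec.fst.comp Primrec.fst))
  have hE₅ : Primrec fun x : Γ₅ => x.1.2 := Primrec.snd.comp Primrec.fst
  have hq₅ : Primrec fun x : Γ₅ => x.1.1.1.1.1.2.1 :=
    Primrec.fst.comp (hq₃.comp (Primrec.fst.comp Primrec.fst))
  have hq'₅ : Primrec fun x : Γ₅ => x.1.1.1.1.1.2.2 :=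
    Primrec.snd.comp (hq₃.comp (Primrec.fst.comp Primrec.fst))
  let B : Γ₅ → List (Fin k → Term I) := fun x =>
    symBag (symTerms x.1.1.1.1.1.2.1 x.1.1.1.1.1.2.2 x.1.1.1.1.2) x.1.1.1.2 x.1.2
      x.1.1.1.1.1.2.1 x.2
  let B' : Γ₅ → List (Fin k → Term I) := fun x =>
    symBag (symTerms x.1.1.1.1.1.2.1 x.1.1.1.1.1.2.2 x.1.1.1.1.2) x.1.1.1.2 x.1.2
      x.1.1.1.1.1.2.2 x.2
  have hB : Primrec B := primrec_symBag hT₅ hL₅ hE₅ hq₅ Primrec.snd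
  have hB' : Primrec B' := primrec_symBag hT₅ hL₅ hE₅ hq'₅ Primrec.snd
  have hnil : PrimrecPred fun x => B x = [] := Primrec.eq.comp hB (Primrec.const [])
  have hnil' : PrimrecPred fun x => B' x = [] := Primrec.eq.comp hB' (Primrec.const [])
  let V : Γ₅ → Prop := fun x => IsOrderedIdentity
      (symTerms x.1.1.1.1.1.2.1 x.1.1.1.1.1.2.2 x.1.1.1.1.2, x.1.1.1.2, B x, B' x) ∧
    IdentityValid α
      (symTerms x.1.1.1.1.1.2.1 x.1.1.1.1.1.2.2 x.1.1.1.1.2, x.1.1.1.2, B x, B' x)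
  have hV : ComputablePred V := ComputablePred.comp h
    (hT₅.pair (hL₅.pair (hB.pair hB'))).to_comp
  have hC₅ : ComputablePred fun x : Γ₅ => (B x = [] ↔ B' x = []) ∧ (B x = [] ∨ V x) :=
    ComputablePred.and (((hnil.imp hnil').and (hnil'.imp hnil)).of_eq
      fun x => iff_def.symm).computablePred (hnil.computablePred.or hV)
  have hC₄ := ComputablePred.ball (f := fun x : Γ₄ =>
      listsOf (symTerms x.1.1.1.1.2.1 x.1.1.1.1.2.2 x.1.1.1.2) x.1.1.1.1.2.1.group.length ++
      listsOf (symTerms x.1.1.1.1.2.1 x.1.1.1.1.2.2 x.1.1.1.2) x.1.1.1.1.2.2.group.length)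
    (Primrec.list_append.comp
      (Primrec.listsOf hT₄ (Primrec.list_length.comp (Query.primrec_group.comp
        (Primrec.fst.comp (hq₃.comp Primrec.fst)))))
      (Primrec.listsOf hT₄ (Primrec.list_length.comp (Query.primrec_group.comp
        (Primrec.snd.comp (hq₃.comp Primrec.fst)))))).to_comp hC₅
  have hC₃ := (PrimrecPred.computablePred (p := fun x : Γ₃ => x.2.length ≤ x.1.1.1.1)
      (Primrec.nat_le.comp (Primrec.list_length.comp Primrec.snd) (Primrec.fst.comp
        (Primrec.fst.comp (Primrec.fst.comp Primrec.fst))))).imp <|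
    ComputablePred.ball (f := fun x : Γ₃ =>
      (factsOver x.2 (x.1.1.1.2.1.sig ++ x.1.1.1.2.2.sig)).sublists')
      (Primrec.list_sublists'.comp (primrec_factsOver Primrec.snd
        (Primrec.list_append.comp (Query.primrec_sig.comp (Primrec.fst.comp hq₃))
          (Query.primrec_sig.comp (Primrec.snd.comp hq₃))))).to_comp hC₄
  have hC₂ := (ComputablePred.and (p := fun x : Γ₂ =>
        IsCompleteOrdering x.2 (symTerms x.1.1.2.1 x.1.1.2.2 x.1.2))
      (h.isCompleteOrdering.comp (Primrec.snd.pair (hT₁.comp Primrec.fst)).to_comp)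
      (primrecPred_isDiagram (hT₁.comp Primrec.fst) Primrec.snd).computablePred).imp <|
    ComputablePred.ball (f := fun x : Γ₂ => (symTerms x.1.1.2.1 x.1.1.2.2 x.1.2).sublists')
      (Primrec.list_sublists'.comp (hT₁.comp Primrec.fst)).to_comp hC₃
  have hC₁ := ComputablePred.ball (f := fun x : Γ₁ =>
      (ordAtoms (symTerms x.1.2.1 x.1.2.2 x.2)).sublists')
    (Primrec.list_sublists'.comp (primrec_ordAtoms.comp hT₁)).to_comp hC₂
  have hC₀ := ComputablePred.ball (f := fun i : ℕ × Query I k × Query I k =>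
      List.range (i.1 + 1))
    (Primrec.list_range.comp (Primrec.succ.comp Primrec.fst)).to_comp hC₁
  refine ((hdisj.comp (Computable.fst.comp Computable.snd)).and
    ((hdisj.comp (Computable.snd.comp Computable.snd)).and hC₀)).of_eq fun i => ?_
  refine and_congr_right fun hq => and_congr_right fun hq' => ?_
  refine forall₂_congr fun m _ => forall₂_congr fun L _ => forall_congr' fun hL =>
    forall₂_congr fun W _ => forall_congr' fun _ => forall₂_congr fun E _ =>
    forall₂_congr fun d _ => and_congr_right fun _ => or_congr_right ?_
  -- The procedure decides validity only jointly with well-formedness, but the latter is automatic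
  -- here: `L` is complete and symbolic bags use terms of `T` only.
  exact and_iff_right ⟨hL.1, forall_mem_symBag hq, forall_mem_symBag hq'⟩

theorem OrderDecidable.boundedEquivalenceDecidable {I : Type u} [LinearOrder I] [Nonempty I]
    [Primcodable I] {β : Type v} {k : ℕ} {α : Multiset (Fin k → I) → β}
    (h : OrderDecidable α) : BoundedEquivalenceDecidable α Query.IsDisjunctive := by
  have hpos : PrimrecPred fun i : ℕ × Query I k × Query I k => 0 < i.1 :=
    Primrec.nat_lt.comp (Primrec.const 0) Primrec.fst
  refine (hpos.computablePred.and h.symEquivalent).of_eq fun i => ?_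
  refine and_congr_right fun _ => and_congr_right fun hq => and_congr_right fun hq' => ?_
  exact ⟨fun h => h.nEquivalent hq hq', fun h => h.symEquivalent hq hq'⟩

/-! ### Reduction of ordered identities to bounded equivalence of positive queries -/

section TupleQuery

variable {I : Type u} {k : ℕ}

/-- Renaming of the variables by adding `k`. -/
def Term.shift (k : ℕ) : Term I → Term I
  | .var x => .var (x + k)
  | .const c => .const c

/-- The condition stating that the tuple of the terms `T` is in the relation `0`, that the
comparisons `L` hold, and that the tuple of the first `k` variables equals `s`. -/
def tupleCond (T : List (Term I)) (L : List (OrdAtom I)) (s : Fin k → Term I) : Condition I :=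
  Literal.pos ⟨0, T.map (Term.shift k)⟩ ::
    ((L.map fun o => Literal.cmp ⟨o.lhs.shift k, o.rel, o.rhs.shift k⟩) ++
      List.ofFn fun j => Literal.cmp ⟨.var j, .eq, (s j).shift k⟩)

/-- The positive query that collects the bag `B` for each instance of `T` in the relation `0` that
satisfies `L`. -/
def tupleQuery (T : List (Term I)) (L : List (OrdAtom I)) (B : List (Fin k → Term I)) :
    Query I k where
  group := (T.flatMap Term.vars).map (· + k)
  agg j := j
  body := B.map (tupleCond T L)

theorem Term.eval_shift (γ : ℕ → I) (t : Term I) :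
    (t.shift k).eval γ = t.eval fun x => γ (x + k) := by
  cases t <;> rfl

theorem Term.eval_congr {γ δ : ℕ → I} {t : Term I} (h : ∀ x ∈ t.vars, γ x = δ x) :
    t.eval γ = t.eval δ := by
  cases t with
  | var x => exact h x (by simp [Term.vars])
  | const c => rfl

theorem Term.shift_eq_var {t : Term I} {x : ℕ} (h : t.shift k = .var x) :
    ∃ y, t = .var y ∧ x = y + k := by
  cases t with
  | var y => exact ⟨y, rfl, (Term.var.inj h).symm⟩
  | const c => cases h

theorem Term.mem_or_const_of_shift {T : List (Term I)} {t : Term I} {x : ℕ}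
    (ht : t ∈ T ∨ ∃ c, t = .const c) (h : t.shift k = .var x) :
    k ≤ x ∧ Term.var (x - k) ∈ T := by
  obtain ⟨y, rfl, rfl⟩ := Term.shift_eq_var h
  rcases ht with ht | ⟨c, hc⟩
  · simpa using ht
  · cases hc

variable {T : List (Term I)} {L : List (OrdAtom I)} {s : Fin k → Term I}

theorem limited_tupleCond {x : ℕ} (hx : k ≤ x) (hT : Term.var (x - k) ∈ T) :
    Limited (tupleCond T L s) x := by
  refine .atom (a := ⟨0, T.map (Term.shift k)⟩) (by simp [tupleCond]) ?_
  exact List.mem_map.2 ⟨_, hT, by simp [Term.shift, Nat.sub_add_cancel hx]⟩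

theorem equates_tupleCond (j : Fin k) :
    Equates (tupleCond T L s) (.var j) ((s j).shift k) := by
  refine .inl ?_
  simp only [tupleCond, List.mem_cons, List.mem_append, List.mem_ofFn]
  exact .inr (.inr ⟨j, rfl⟩)

theorem limited_tupleCond_agg (hs : ∀ j, s j ∈ T ∨ ∃ c, s j = .const c) (j : Fin k) :
    Limited (tupleCond T L s) j := by
  have h := equates_tupleCond (T := T) (L := L) (s := s) j
  cases ht : s j with
  | const c => exact .eqConst (c := c) (by rw [ht] at h; exact h)
  | var y =>
    rw [ht] at h
    refine .eqVar (limited_tupleCond (x := y + k) (by simp) ?_) h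
    have := hs j
    rw [ht] at this
    simpa using this

/-- Constants outside `T` are admitted in `s` because the substitute for the empty bag and the
entailment queries use them; they add no variables. -/
theorem occurs_tupleCond (hL : ∀ o ∈ L, o.lhs ∈ T ∧ o.rhs ∈ T)
    (hs : ∀ j, s j ∈ T ∨ ∃ c, s j = .const c) {x : ℕ} :
    Occurs (tupleCond T L s) x ↔ x < k ∨ (k ≤ x ∧ Term.var (x - k) ∈ T) := by
  constructor
  · rintro ⟨l, hl, hx⟩
    simp only [tupleCond, List.mem_cons, List.mem_append, List.mem_map, List.mem_ofFn] at hl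
    rcases hl with rfl | ⟨o, ho, rfl⟩ | ⟨j, rfl⟩
    · obtain ⟨t, ht, e⟩ := List.mem_map.1 hx
      exact .inr (Term.mem_or_const_of_shift (.inl ht) e)
    · simp only [Literal.terms, List.mem_cons, List.not_mem_nil, or_false] at hx
      rcases hx with e | e
      · exact .inr (Term.mem_or_const_of_shift (.inl (hL o ho).1) e.symm)
      · exact .inr (Term.mem_or_const_of_shift (.inl (hL o ho).2) e.symm)
    · simp only [Literal.terms, List.mem_cons, List.not_mem_nil, or_false] at hx
      rcases hx with e | e
      · exact .inl (Term.var.inj e ▸ j.2)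
      · exact .inr (Term.mem_or_const_of_shift (hs j) e.symm)
  · rintro (h | ⟨h, hT⟩)
    · exact (limited_tupleCond_agg hs ⟨x, h⟩).occurs
    · exact (limited_tupleCond h hT).occurs

theorem isPositiveDisjunctive_tupleQuery {B : List (Fin k → Term I)}
    (hL : ∀ o ∈ L, o.lhs ∈ T ∧ o.rhs ∈ T)
    (hB : ∀ s ∈ B, ∀ j, s j ∈ T ∨ ∃ c, s j = .const c) :
    (tupleQuery T L B).IsPositiveDisjunctive := by
  refine ⟨fun A hA => ?_, fun A hA a ha => ?_⟩ <;> obtain ⟨s, hs, rfl⟩ := List.mem_map.1 hA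
  · refine ⟨fun x hx => ?_, fun x hx => ?_, fun j => (limited_tupleCond_agg (hB s hs) j).occurs⟩
    · rcases (occurs_tupleCond hL (hB s hs)).1 hx with h | ⟨h, hT⟩
      · exact limited_tupleCond_agg (hB s hs) ⟨x, h⟩
      · exact limited_tupleCond h hT
    · obtain ⟨y, hy, rfl⟩ := List.mem_map.1 hx
      obtain ⟨t, ht, hy⟩ := List.mem_flatMap.1 hy
      rw [Term.mem_vars] at hy
      subst hy
      exact (limited_tupleCond (by simp) (by simpa using ht)).occurs
  · simp [tupleCond, List.mem_ofFn] at ha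

/-- There is a bag of constants with the same value as the empty bag, which is nonempty if
possible. -/
theorem exists_bag_same_value_as_empty {β : Type v} (α : Multiset (Fin k → I) → β) :
    ∃ E : List (Fin k → Term I), (∀ s ∈ E, ∀ j, ∃ c, s j = .const c) ∧
      (∀ δ, α (instBag δ E) = α 0) ∧ (E = [] → ∀ M, α M = α 0 → M = 0) := by
  by_cases h : ∃ M, α M = α 0 ∧ M ≠ 0
  · obtain ⟨M, hM, hne⟩ := h
    have hinst : ∀ δ : ℕ → I, instBag δ (M.toList.map fun f j => Term.const (f j)) = M := by
      intro δ
      rw [instBag, List.map_map, ← Multiset.map_coe, Multiset.coe_toList]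
      exact Multiset.map_id M
    refine ⟨M.toList.map fun f j => .const (f j), ?_, fun δ => by rw [hinst, hM], fun hE => ?_⟩
    · simp only [List.mem_map]
      rintro _ ⟨f, -, rfl⟩ j
      exact ⟨_, rfl⟩
    · simp [hne] at hE
  · push Not at h
    exact ⟨[], by simp, fun δ => rfl, fun _ M hM => h M hM⟩

variable [LinearOrder I]

theorem sat_tupleCond {D : Database I} {γ : ℕ → I} :
    (∀ l ∈ tupleCond T L s, l.Sat D γ) ↔ (0, T.map (Term.eval fun x => γ (x + k))) ∈ D ∧
      (∀ o ∈ L, o.Sat fun x => γ (x + k)) ∧ ∀ j : Fin k, γ j = (s j).eval fun x => γ (x + k) := by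
  simp only [tupleCond, List.forall_mem_cons, List.forall_mem_append, List.forall_mem_map,
    List.mem_ofFn, forall_exists_index, forall_apply_eq_imp_iff, Literal.Sat, OrdAtom.Sat,
    Term.eval_shift, List.map_map]
  refine and_congr ?_ Iff.rfl
  rw [List.map_congr_left (f := Term.eval γ ∘ Term.shift k)]
  exact fun t _ => Term.eval_shift γ t

variable [Nonempty I] {β : Type v} {D : Database I} {δ : ℕ → I}

/-- The group fixes all variables of `T` and the equalities then fix the first `k` variables, so
exactly one assignment qualifies. -/
theorem conditionBag_tupleCond (hL : ∀ o ∈ L, o.lhs ∈ T ∧ o.rhs ∈ T)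
    (hs : ∀ j, s j ∈ T ∨ ∃ c, s j = .const c) (hδ : ∀ o ∈ L, o.Sat δ)
    (hD : (0, T.map (Term.eval δ)) ∈ D) :
    conditionBag (tupleCond T L s) D ((T.flatMap Term.vars).map (· + k)) (fun j => (j : ℕ))
      ((T.flatMap Term.vars).map δ) = {fun j => (s j).eval δ} := by
  classical
  have heval : ∀ γ : ℕ → I, (∀ x, Term.var x ∈ T → γ (x + k) = δ x) → ∀ t,
      (t ∈ T ∨ ∃ c, t = .const c) → (t.eval fun x => γ (x + k)) = t.eval δ := by
    rintro γ hγ t (ht | ⟨c, rfl⟩)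
    · refine Term.eval_congr fun x hx => hγ x ?_
      rwa [← Term.mem_vars.1 hx]
    · rfl
  -- The only candidate: the values of `s` below `k`, then `δ` shifted by `k`, and the default value
  -- on variables that do not occur.
  obtain ⟨γ₀, hagg, hgr, hdef⟩ : ∃ γ₀ : ℕ → I, (∀ j : Fin k, γ₀ j = (s j).eval δ) ∧
      (∀ x, Term.var x ∈ T → γ₀ (x + k) = δ x) ∧
      ∀ x, ¬ (x < k ∨ (k ≤ x ∧ Term.var (x - k) ∈ T)) → γ₀ x = Classical.arbitrary I := by
    refine ⟨fun x => if h : x < k then (s ⟨x, h⟩).eval δ else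
      if Term.var (x - k) ∈ T then δ (x - k) else Classical.arbitrary I, fun j => dif_pos j.2,
      fun x hx => by simp [hx], fun x hx => ?_⟩
    have h₁ : ¬ x < k := fun h => hx (.inl h)
    exact (dif_neg h₁).trans (if_neg fun h => hx (.inr ⟨not_lt.1 h₁, h⟩))
  have hset : {γ ∈ satAssignments (tupleCond T L s) D |
      ((T.flatMap Term.vars).map (· + k)).map γ = (T.flatMap Term.vars).map δ} = {γ₀} := by
    ext γ
    simp only [Set.mem_ofPred_eq, Set.mem_singleton_iff, List.map_map, List.map_inj_left,
      satAssignments, sat_tupleCond, occurs_tupleCond hL hs, List.mem_flatMap, Term.mem_vars,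
      exists_eq_right, Function.comp]
    constructor
    · rintro ⟨⟨hdef', -, -, hagg'⟩, hgr'⟩
      funext x
      by_cases hx : x < k ∨ (k ≤ x ∧ Term.var (x - k) ∈ T)
      · rcases hx with h | ⟨h, hT⟩
        · exact (hagg' ⟨x, h⟩).trans ((heval γ hgr' _ (hs _)).trans (hagg ⟨x, h⟩).symm)
        · have := (hgr' _ hT).trans (hgr _ hT).symm
          rwa [Nat.sub_add_cancel h] at this
      · rw [hdef x hx, hdef' x hx]
    · rintro rfl
      have hev := heval _ hgr
      refine ⟨⟨hdef, ?_, fun o ho => ?_, fun j => ?_⟩, hgr⟩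
      · rwa [List.map_congr_left fun t ht => hev t (.inl ht)]
      · rw [OrdAtom.Sat, hev _ (.inl (hL o ho).1), hev _ (.inl (hL o ho).2)]
        exact hδ o ho
      · rw [hev _ (hs j), hagg]
  have hfin : {γ ∈ satAssignments (tupleCond T L s) D |
      ((T.flatMap Term.vars).map (· + k)).map γ = (T.flatMap Term.vars).map δ}.Finite :=
    hset ▸ Set.finite_singleton _
  have htoF : hfin.toFinset = {γ₀} := by
    ext γ
    rw [Set.Finite.mem_toFinset, hset, Set.mem_singleton_iff, Finset.mem_singleton]
  rw [conditionBag, dif_pos hfin, htoF, Finset.singleton_val, Multiset.map_singleton]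
  congr 1
  funext j
  exact hagg j

/-- Each disjunct contributes a single tuple, and equal disjuncts are counted separately, so the
multiplicities of `B` are reproduced. -/
theorem bag_tupleQuery {B : List (Fin k → Term I)} (hL : ∀ o ∈ L, o.lhs ∈ T ∧ o.rhs ∈ T)
    (hB : ∀ s ∈ B, ∀ j, s j ∈ T ∨ ∃ c, s j = .const c) (hδ : ∀ o ∈ L, o.Sat δ)
    (hD : (0, T.map (Term.eval δ)) ∈ D) :
    (tupleQuery T L B).bag D ((T.flatMap Term.vars).map δ) = instBag δ B := by
  simp only [Query.bag, tupleQuery, List.map_map]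
  induction B with
  | nil => rfl
  | cons s B ih =>
    rw [List.map_cons, List.sum_cons, ih fun t ht => hB t (by simp [ht]), Function.comp,
      conditionBag_tupleCond hL (hB s (by simp)) hδ hD]
    rfl

theorem exists_of_bag_tupleQuery_ne {B : List (Fin k → Term I)} {d : List I}
    (h : (tupleQuery T L B).bag D d ≠ 0) : ∃ δ : ℕ → I, (∀ o ∈ L, o.Sat δ) ∧
      (0, T.map (Term.eval δ)) ∈ D ∧ (T.flatMap Term.vars).map δ = d := by
  obtain ⟨A, hA, γ, hγ, hd⟩ := Query.exists_of_bag_ne h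
  obtain ⟨s, -, rfl⟩ := List.mem_map.1 hA
  obtain ⟨h₁, h₂, -⟩ := sat_tupleCond.1 hγ.2
  exact ⟨_, h₂, h₁, by rw [← hd, tupleQuery, List.map_map]; rfl⟩

/-- Bounded equivalence of tuple queries expresses an identity of the aggregation function. -/
theorem nEquivalent_tupleQuery_iff {α : Multiset (Fin k → I) → β}
    {B B' : List (Fin k → Term I)} (hL : ∀ o ∈ L, o.lhs ∈ T ∧ o.rhs ∈ T)
    (hB : ∀ s ∈ B, ∀ j, s j ∈ T ∨ ∃ c, s j = .const c)
    (hB' : ∀ s ∈ B', ∀ j, s j ∈ T ∨ ∃ c, s j = .const c) :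
    NEquivalent α (T.length + 1) (tupleQuery T L B) (tupleQuery T L B') ↔
      ∀ δ : ℕ → I, (∀ o ∈ L, o.Sat δ) → (B = [] ↔ B' = []) ∧
        (B = [] ∨ α (instBag δ B) = α (instBag δ B')) := by
  constructor
  · intro h δ hδ
    have hD : (0, T.map (Term.eval δ)) ∈ ({(0, T.map (Term.eval δ))} : Database I) := by simp
    -- The one-fact database needs only `T.length` elements; the extra one keeps the bound positive
    -- when `T` is empty.
    have hcard : (carrier ({(0, T.map (Term.eval δ))} : Database I)).card ≤ T.length + 1 := by
      rw [carrier, Finset.singleton_biUnion]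
      exact (List.toFinset_card_le _).trans (by simp)
    have := Query.result_eq_iff.1 (h _ hcard) ((T.flatMap Term.vars).map δ)
    rwa [bag_tupleQuery hL hB hδ hD, bag_tupleQuery hL hB' hδ hD, instBag_eq_zero,
      instBag_eq_zero] at this
  · intro h D _
    refine Query.result_eq_iff.2 fun d => ?_
    by_cases hd : (tupleQuery T L B).bag D d = 0 ∧ (tupleQuery T L B').bag D d = 0
    · simp [hd]
    · obtain ⟨δ, hδ, hD, rfl⟩ : ∃ δ : ℕ → I, (∀ o ∈ L, o.Sat δ) ∧
          (0, T.map (Term.eval δ)) ∈ D ∧ (T.flatMap Term.vars).map δ = d := by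
        rcases not_and_or.1 hd with hd | hd <;> exact exists_of_bag_tupleQuery_ne hd
      rw [bag_tupleQuery hL hB hδ hD, bag_tupleQuery hL hB' hδ hD, instBag_eq_zero,
        instBag_eq_zero]
      exact h δ hδ

/-- The pair of queries that are equivalent if and only if `L` entails `a rel b`. -/
def entailmentQueries (k : ℕ) (c : I) (T : List (Term I)) (L : List (OrdAtom I)) (a : Term I)
    (r : OrdRel) (b : Term I) : ℕ × Query I k × Query I k :=
  (T.length + 1, tupleQuery T (⟨a, r.negate, b⟩ :: L) [fun _ => .const c],
    tupleQuery T (⟨a, r.negate, b⟩ :: L) [])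

/-- The first query returns something exactly when some fact comes from a model of `L` violating `a
r b`; the second, having no disjunct, never does. The constant `c` merely makes the bag nonempty, so
`α` plays no role. -/
theorem entails_iff (α : Multiset (Fin k → I) → β) (c : I) (hL : ∀ o ∈ L, o.lhs ∈ T ∧ o.rhs ∈ T)
    {a b : Term I} (ha : a ∈ T) (hb : b ∈ T) {r : OrdRel} :
    (0 < (entailmentQueries k c T L a r b).1 ∧
      (entailmentQueries k c T L a r b).2.1.IsPositiveDisjunctive ∧
      (entailmentQueries k c T L a r b).2.2.IsPositiveDisjunctive ∧
      NEquivalent α (entailmentQueries k c T L a r b).1 (entailmentQueries k c T L a r b).2.1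
        (entailmentQueries k c T L a r b).2.2) ↔ Entails L a r b := by
  have hL' : ∀ o ∈ (⟨a, r.negate, b⟩ : OrdAtom I) :: L, o.lhs ∈ T ∧ o.rhs ∈ T := by
    simpa [ha, hb] using hL
  have hc : ∀ s ∈ [fun _ : Fin k => Term.const c], ∀ j, s j ∈ T ∨ ∃ c, s j = .const c := by
    simp
  rw [entailmentQueries, nEquivalent_tupleQuery_iff hL' hc (by simp)]
  have h₁ := isPositiveDisjunctive_tupleQuery hL' hc
  have h₂ := isPositiveDisjunctive_tupleQuery (B := ([] : List (Fin k → Term I))) hL' (by simp)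
  simp only [h₁, h₂, Nat.succ_pos, true_and, List.forall_mem_cons, Entails, List.cons_ne_nil,
    iff_true, false_and, imp_false, not_and]
  refine forall_congr' fun δ => ?_
  rw [OrdAtom.Sat, OrdRel.holds_negate]
  tauto

open Classical in
/-- The pair of queries that are equivalent if and only if the given identity is valid. The empty
bag is replaced with `E`. -/
noncomputable def identityQueries (E : List (Fin k → Term I)) (i : IdentityData I k) :
    ℕ × Query I k × Query I k :=
  (i.1.length + 1, tupleQuery i.1 i.2.1 (if i.2.2.1 = [] then E else i.2.2.1),
    tupleQuery i.1 i.2.1 (if i.2.2.2 = [] then E else i.2.2.2))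

theorem identityValid_iff {α : Multiset (Fin k → I) → β} {E : List (Fin k → Term I)}
    (hEc : ∀ s ∈ E, ∀ j, ∃ c, s j = .const c) (hE : ∀ δ, α (instBag δ E) = α 0)
    (hE0 : E = [] → ∀ M, α M = α 0 → M = 0) {B B' : List (Fin k → Term I)}
    (hL : ∀ o ∈ L, o.lhs ∈ T ∧ o.rhs ∈ T) (hB : ∀ s ∈ B, ∀ j, s j ∈ T)
    (hB' : ∀ s ∈ B', ∀ j, s j ∈ T) :
    (0 < (identityQueries E (T, L, B, B')).1 ∧
      (identityQueries E (T, L, B, B')).2.1.IsPositiveDisjunctive ∧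
      (identityQueries E (T, L, B, B')).2.2.IsPositiveDisjunctive ∧
      NEquivalent α (identityQueries E (T, L, B, B')).1 (identityQueries E (T, L, B, B')).2.1
        (identityQueries E (T, L, B, B')).2.2) ↔ IdentityValid α (T, L, B, B') := by
  classical
  have hwf : ∀ B : List (Fin k → Term I), (∀ s ∈ B, ∀ j, s j ∈ T) →
      ∀ s ∈ (if B = [] then E else B), ∀ j, s j ∈ T ∨ ∃ c, s j = .const c := by
    intro B hB s hs j
    split_ifs at hs with h
    · exact .inr (hEc s hs j)
    · exact .inl (hB s hs j)
  have hval : ∀ (B : List (Fin k → Term I)) δ,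
      α (instBag δ (if B = [] then E else B)) = α (instBag δ B) := by
    intro B δ
    split_ifs with h
    · rw [hE, h]
      rfl
    · rfl
  have hnil : ∀ B : List (Fin k → Term I),
      (if B = [] then E else B) = [] ↔ B = [] ∧ E = [] := by
    intro B
    split_ifs with h <;> simp [h]
  have h₁ := isPositiveDisjunctive_tupleQuery hL (hwf B hB)
  have h₂ := isPositiveDisjunctive_tupleQuery hL (hwf B' hB')
  simp only [identityQueries, nEquivalent_tupleQuery_iff hL (hwf B hB) (hwf B' hB'), h₁, h₂,
    Nat.succ_pos, true_and, hval, hnil, IdentityValid]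
  refine forall₂_congr fun δ hδ => ⟨?_, fun h => ⟨?_, .inr h⟩⟩
  · rintro ⟨h, h' | h'⟩
    · rw [h'.1, (h.1 h').1]
    · exact h'
  -- If `E` is empty, only the empty bag has the value `α 0`, so equal values force both bags to be
  -- empty or neither. If `E` is nonempty, no bag is empty after the replacement.
  · refine and_congr_left fun h0 => ?_
    have h0 := hE0 h0
    constructor
    · rintro rfl
      exact instBag_eq_zero.1 (h0 _ h.symm)
    · rintro rfl
      exact instBag_eq_zero.1 (h0 _ h)

end TupleQuery

/-! ### Computability of the reduction, and order-decidability -/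

section Primrec

variable {I : Type u} [Primcodable I] {k : ℕ} {γ : Type*} [Primcodable γ]

theorem Term.primrec_shift (k : ℕ) : Primrec (Term.shift k : Term I → Term I) :=
  (Term.primrec_casesOn (g := fun _ x => Term.var (x + k)) (h := fun _ c => Term.const c)
    Primrec.id (Term.primrec_var.comp (Primrec.nat_add.comp Primrec.snd (Primrec.const k)))
    (Term.primrec_const.comp Primrec.snd)).of_eq fun t => by cases t <;> rfl

theorem primrec_tupleQuery {T : γ → List (Term I)} {L : γ → List (OrdAtom I)}
    {B : γ → List (Fin k → Term I)} (hT : Primrec T) (hL : Primrec L) (hB : Primrec B) :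
    Primrec fun a => tupleQuery (T a) (L a) (B a) := by
  have hsh : Primrec (Term.shift k : Term I → Term I) := Term.primrec_shift k
  refine Query.primrec_mk (Primrec.list_map (Primrec.list_flatMap hT
      (Term.primrec_vars.comp Primrec.snd)) (Primrec.nat_add.comp Primrec.snd (Primrec.const k)))
    (Primrec.const _) (Primrec.list_map hB ?_)
  refine Primrec.list_cons.comp (Literal.primrec_pos.comp (Atom.primrec_mk (Primrec.const 0)
    (Primrec.list_map (hT.comp Primrec.fst) (hsh.comp Primrec.snd))))
    (Primrec.list_append.comp ?_ ?_)
  · exact Primrec.list_map (hL.comp Primrec.fst) (Literal.primrec_cmp.comp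
      (OrdAtom.primrec_mk (hsh.comp (OrdAtom.primrec_lhs.comp Primrec.snd))
        (OrdAtom.primrec_rel.comp Primrec.snd)
        (hsh.comp (OrdAtom.primrec_rhs.comp Primrec.snd))))
  · exact Primrec.list_ofFn fun j => Literal.primrec_cmp.comp
      (OrdAtom.primrec_mk (Primrec.const _) (Primrec.const _)
        (hsh.comp (Primrec.fin_app.comp Primrec.snd (Primrec.const j))))

theorem primrec_entailmentQueries (k : ℕ) (c : I) {T : γ → List (Term I)}
    {L : γ → List (OrdAtom I)} {a b : γ → Term I} (r : OrdRel) (hT : Primrec T)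
    (hL : Primrec L) (ha : Primrec a) (hb : Primrec b) :
    Primrec fun x => entailmentQueries k c (T x) (L x) (a x) r (b x) := by
  have hL' : Primrec fun x => (⟨a x, r.negate, b x⟩ : OrdAtom I) :: L x :=
    Primrec.list_cons.comp (OrdAtom.primrec_mk ha (Primrec.const _) hb) hL
  exact (Primrec.succ.comp (Primrec.list_length.comp hT)).pair
    ((primrec_tupleQuery hT hL' (Primrec.const _)).pair
      (primrec_tupleQuery hT hL' (Primrec.const _)))

theorem primrec_identityQueries (E : List (Fin k → Term I)) : Primrec (identityQueries E) := by
  classical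
  have hB : Primrec fun i : IdentityData I k => i.2.2.1 :=
    Primrec.fst.comp (Primrec.snd.comp Primrec.snd)
  have hB' : Primrec fun i : IdentityData I k => i.2.2.2 :=
    Primrec.snd.comp (Primrec.snd.comp Primrec.snd)
  have hL : Primrec fun i : IdentityData I k => i.2.1 := Primrec.fst.comp Primrec.snd
  exact (Primrec.succ.comp (Primrec.list_length.comp Primrec.fst)).pair
    ((primrec_tupleQuery Primrec.fst hL (Primrec.ite (Primrec.eq.comp hB (Primrec.const []))
      (Primrec.const E) hB)).pair
    (primrec_tupleQuery Primrec.fst hL (Primrec.ite (Primrec.eq.comp hB' (Primrec.const []))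
      (Primrec.const E) hB')))

theorem primrecPred_termsMem {B : γ → List (Fin k → Term I)} {T : γ → List (Term I)}
    (hB : Primrec B) (hT : Primrec T) : PrimrecPred fun a => ∀ s ∈ B a, ∀ j, s j ∈ T a := by
  refine PrimrecPred.of_eq (p := fun a => ∀ s ∈ B a, ∀ t ∈ List.ofFn s, t ∈ T a) ?_
    fun a => by simp only [List.mem_ofFn, forall_exists_index, forall_apply_eq_imp_iff]
  refine PrimrecPred.ball (p := fun a s => ∀ t ∈ List.ofFn s, t ∈ T a) hB ?_
  exact PrimrecPred.ball (p := fun (x : γ × (Fin k → Term I)) t => t ∈ T x.1)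
    (Primrec.list_ofFn fun j => Primrec.fin_app.comp Primrec.snd (Primrec.const j))
    (PrimrecPred.list_mem Primrec.snd (hT.comp (Primrec.fst.comp Primrec.fst)))

end Primrec

theorem BoundedEquivalenceDecidable.orderDecidable {I : Type u} [LinearOrder I] [Nonempty I]
    [Primcodable I] {β : Type v} {k : ℕ} {α : Multiset (Fin k → I) → β}
    (h : BoundedEquivalenceDecidable α Query.IsPositiveDisjunctive) : OrderDecidable α := by
  -- The choices of `E` and `c` need not be effective: they depend only on `α` and `I`, not on the
  -- input, and are built into the algorithm as fixed data.
  obtain ⟨E, hEc, hE, hE0⟩ := exists_bag_same_value_as_empty α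
  let c : I := Classical.arbitrary I
  let Ent : OrdRel → (IdentityData I k × Term I) × Term I → Prop := fun r x =>
    0 < (entailmentQueries k c x.1.1.1 x.1.1.2.1 x.1.2 r x.2).1 ∧
      (entailmentQueries k c x.1.1.1 x.1.1.2.1 x.1.2 r x.2).2.1.IsPositiveDisjunctive ∧
      (entailmentQueries k c x.1.1.1 x.1.1.2.1 x.1.2 r x.2).2.2.IsPositiveDisjunctive ∧
      NEquivalent α (entailmentQueries k c x.1.1.1 x.1.1.2.1 x.1.2 r x.2).1
        (entailmentQueries k c x.1.1.1 x.1.1.2.1 x.1.2 r x.2).2.1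
        (entailmentQueries k c x.1.1.1 x.1.1.2.1 x.1.2 r x.2).2.2
  have hEnt : ∀ r, ComputablePred (Ent r) := fun r => ComputablePred.comp h
    (primrec_entailmentQueries k c r (Primrec.fst.comp (Primrec.fst.comp Primrec.fst))
      (Primrec.fst.comp (Primrec.snd.comp (Primrec.fst.comp Primrec.fst)))
      (Primrec.snd.comp Primrec.fst) Primrec.snd).to_comp
  have hone := ((hEnt .lt).and ((hEnt .gt).not.and (hEnt .eq).not)).or
    (((hEnt .lt).not.and ((hEnt .gt).and (hEnt .eq).not)).or
      ((hEnt .lt).not.and ((hEnt .gt).not.and (hEnt .eq))))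
  have hcomplete := ComputablePred.ball (f := fun i : IdentityData I k => i.1) Computable.fst
    (ComputablePred.ball (f := fun x : IdentityData I k × Term I => x.1.1)
      (Computable.fst.comp Computable.fst) hone)
  have hvalid := ComputablePred.comp h (primrec_identityQueries E).to_comp
  have hover : PrimrecPred fun i : IdentityData I k =>
      (∀ o ∈ i.2.1, o.lhs ∈ i.1 ∧ o.rhs ∈ i.1) ∧ (∀ s ∈ i.2.2.1, ∀ j, s j ∈ i.1) ∧
        ∀ s ∈ i.2.2.2, ∀ j, s j ∈ i.1 := by
    refine PrimrecPred.and ?_ (PrimrecPred.and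
      (primrecPred_termsMem (Primrec.fst.comp (Primrec.snd.comp Primrec.snd)) Primrec.fst)
      (primrecPred_termsMem (Primrec.snd.comp (Primrec.snd.comp Primrec.snd)) Primrec.fst))
    exact PrimrecPred.ball (p := fun (i : IdentityData I k) (o : OrdAtom I) =>
        o.lhs ∈ i.1 ∧ o.rhs ∈ i.1) (Primrec.fst.comp Primrec.snd)
      ((PrimrecPred.list_mem (OrdAtom.primrec_lhs.comp Primrec.snd)
        (Primrec.fst.comp Primrec.fst)).and
        (PrimrecPred.list_mem (OrdAtom.primrec_rhs.comp Primrec.snd)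
          (Primrec.fst.comp Primrec.fst)))
  -- The check that `L`, `B` and `B'` are over `T` is part of the test because the answers about
  -- entailment and validity are meaningful only then.
  refine (hover.computablePred.and (hcomplete.and hvalid)).of_eq ?_
  rintro ⟨T, L, B, B'⟩
  constructor
  · rintro ⟨⟨hL, hB, hB'⟩, hc, hv⟩
    refine ⟨⟨⟨hL, fun s hs t ht => ?_⟩, hB, hB'⟩,
      (identityValid_iff hEc hE hE0 hL hB hB').1 hv⟩
    simpa only [Ent, entails_iff α c hL hs ht] using hc s hs t ht
  · rintro ⟨⟨⟨hL, hc⟩, hB, hB'⟩, hv⟩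
    refine ⟨⟨hL, hB, hB'⟩, fun s hs t ht => ?_,
      (identityValid_iff hEc hE hE0 hL hB hB').2 hv⟩
    simpa only [Ent, entails_iff α c hL hs ht] using hc s hs t ht

end AggregateQuery

theorem mainTheorem8 {I : Type*} [LinearOrder I] [Nonempty I] [Primcodable I] {β : Type*} (k : ℕ)
    (α : Multiset (Fin k → I) → β) :
    (AggregateQuery.BoundedEquivalenceDecidable α AggregateQuery.Query.IsPositiveDisjunctive ↔
      AggregateQuery.BoundedEquivalenceDecidable α AggregateQuery.Query.IsDisjunctive) ∧
    (AggregateQuery.BoundedEquivalenceDecidable α AggregateQuery.Query.IsPositiveDisjunctive ↔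
      AggregateQuery.OrderDecidable α) ∧
    (AggregateQuery.BoundedEquivalenceDecidable α AggregateQuery.Query.IsDisjunctive ↔
      AggregateQuery.OrderDecidable α) := by
  have h₁₃ : AggregateQuery.BoundedEquivalenceDecidable α
      AggregateQuery.Query.IsPositiveDisjunctive → AggregateQuery.OrderDecidable α :=
    fun h => h.orderDecidable
  have h₃₂ : AggregateQuery.OrderDecidable α → AggregateQuery.BoundedEquivalenceDecidable α
      AggregateQuery.Query.IsDisjunctive := fun h => h.boundedEquivalenceDecidable
  have h₂₁ : AggregateQuery.BoundedEquivalenceDecidable α AggregateQuery.Query.IsDisjunctive →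
      AggregateQuery.BoundedEquivalenceDecidable α
        AggregateQuery.Query.IsPositiveDisjunctive :=
    AggregateQuery.boundedEquivalenceDecidable_positive
  exact ⟨⟨h₃₂ ∘ h₁₃, h₂₁⟩, ⟨h₁₃, h₂₁ ∘ h₃₂⟩, ⟨h₁₃ ∘ h₂₁, h₃₂⟩⟩
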